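/- **Setting.** For each $n$ let $M=M_n$ be a (deterministic) symmetric $n\times n$ real matrix of rank $k=k_n\ge 1$ with reduced eigendecomposition $M=U\Lambda U^\top$, where $U\in\mathbb R^{n\times k}$ has orthonormal columns and $\Lambda=\mathrm{diag}(\lambda_1,\dots,\lambda_k)$ holds the nonzero eigenvalues, $|\lambda_1|\ge\dots\ge|\lambda_k|>0$. Put $\psi=|\lambda_1/\lambda_k|$ and $S_n=\|M\|$ (spectral norm). One observes $\hat M=M+E$, where $E$ is a random symmetric $n\times n$ matrix for which there are a fixed $\beta_\Delta>0$ and numbers $E_n$ such that $S_n/E_n\gtrsim n^{\beta_\Delta}$ and $\mathbb P[\|E\|\le E_n]\ge 1-n^{-6}$ for all sufficiently large $n$. Here $x_n\gtrsim y_n$ (equivalently $y_n\lesssim x_n$) means that $y_n\le c\,x_n$ for all but finitely many $n$, with a constant $c>0$ not depending on $n$. **Algorithm (rs-RSVD).** Given integers $g,a_n\ge 1$ and $\tilde k=\tilde k_n\ge k$, let $G_1,\dots,G_{a_n}$ be independent $n\times\tilde k$ matrices with i.i.d. standard normal entries, independent of $E$. Choose $\tilde a\in\{1,\dots,a_n\}$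 maximizing the $k$-th largest singular value of $\hat M^gG_a$, and let $\hat U_g\in\mathbb R^{n\times k}$ consist of $k$ leading left singular vectors of $\hat M^gG_{\tilde a}$. For $n\times k$ matrices $U_1,U_2$ with orthonormal columns let $d_2(U_1,U_2)=\inf_W\|U_1-U_2W\|$, the infimum over orthogonal $k\times k$ matrices $W$, and let $\Theta(U_1,U_2)$ be the diagonal matrix of the principal angles, whose cosines are the singular values of $U_1^\top U_2$. Let $\vartheta=\max\{1,\tilde k^{-1/2}\log^{1/2}n\}$. **Theorem.** Suppose that one of the following holds: (a) $k$ and $\tilde k$ are fixed; (b) $k$ is fixed and $\tilde k\to\infty$ as $n\to\infty$; (c) $k\to\infty$ as $n\to\infty$ and $\tilde k\ge c_{\mathrm{gap}}k$ for a fixed $c_{\mathrm{gap}}>1$. There is a constant $C>0$, not depending on $n$ (it depends only on $k$ and $\tilde k$ in case (a), is at most $15$ in case (b), and depends only on $c_{\mathrm{gap}}$ in case (c)), such that the following holds. If $\psi=o(S_n/E_n)$ and $a_n\ge\lceil C\tilde k^{-1}\log n\rceil$ for all sufficiently large $n$, then for every fixed integer $g\ge 1+(2\beta_\Delta)^{-1}$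 there is a constant $c>0$ not depending on $n$ such that, for all sufficiently large $n$, with probability at least $1-n^{-5}$, $$d_2(\hat U_g,U)\le\sqrt2\,\|\sin\Theta(\hat U_g,U)\|\le c\,\vartheta\,\psi^g\,\frac{E_n}{S_n}.$$ -/

import Mathlib

open MeasureTheory ProbabilityTheory Filter Asymptotics
open scoped Matrix Matrix.Norms.L2Operator

/-- The singular values `σ₁ ≥ σ₂ ≥ ...` of a real matrix, indexed from `0` (so that `sv A i` is the
`(i+1)`-th largest one) and extended by zeros. -/
noncomputable def sv {n m : ℕ} (A : Matrix (Fin n) (Fin m) ℝ) (i : ℕ) : ℝ :=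
  (Matrix.toEuclideanLin A).singularValues i

/-- `Y = P Σ Qᵀ` is a (full) singular value decomposition of `Y`: `P` and `Q` are orthogonal and
`Σ` is the rectangular diagonal matrix of the singular values in decreasing order. -/
def IsSVD {n m : ℕ} (Y : Matrix (Fin n) (Fin m) ℝ) (P : Matrix (Fin n) (Fin n) ℝ)
    (Q : Matrix (Fin m) (Fin m) ℝ) : Prop :=
  P ∈ Matrix.orthogonalGroup (Fin n) ℝ ∧ Q ∈ Matrix.orthogonalGroup (Fin m) ℝ ∧
    Y = P * Matrix.of (fun (i : Fin n) (j : Fin m) => if (i : ℕ) = (j : ℕ) then sv Y i else 0) * Qᵀ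

/-- The columns of `V` are `k` leading left singular vectors of `Y`, i.e. the first `k` left
singular vectors of some singular value decomposition of `Y`. -/
def IsLeadingLeftSingular {n m k : ℕ} (Y : Matrix (Fin n) (Fin m) ℝ)
    (V : Matrix (Fin n) (Fin k) ℝ) : Prop :=
  ∃ (P : Matrix (Fin n) (Fin n) ℝ) (Q : Matrix (Fin m) (Fin m) ℝ) (hk : k ≤ n),
    IsSVD Y P Q ∧ V = P.submatrix id (Fin.castLE hk)

/-- `V` is a possible output `Û_g` of the repeated-sampling randomized SVD with input matrix `Mhat`,
rank `k`, power `g`, sketching dimension `kt` and sketching matrices `G 0, ..., G (a - 1)`: for some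
index `b` that maximizes the `k`-th singular value of `Mhat ^ g * G b`, the columns of `V` are `k`
leading left singular vectors of `Mhat ^ g * G b`. (Ties and the non-uniqueness of singular vectors
may be resolved in any way.) -/
def IsRsRSVDOutput {n k kt a : ℕ} (g : ℕ) (Mhat : Matrix (Fin n) (Fin n) ℝ)
    (G : Fin a → Matrix (Fin n) (Fin kt) ℝ) (V : Matrix (Fin n) (Fin k) ℝ) : Prop :=
  ∃ b : Fin a, (∀ b' : Fin a, sv (Mhat ^ g * G b') (k - 1) ≤ sv (Mhat ^ g * G b) (k - 1)) ∧
    IsLeadingLeftSingular (Mhat ^ g * G b) V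

/-- `M = U Λ Uᵀ` is the reduced eigendecomposition of a symmetric matrix `M` of rank `k`: the
columns of `U` are orthonormal and `Λ = diag(lam)` holds the `k` nonzero eigenvalues of `M`, in
decreasing order of magnitude. -/
structure IsEigendecomposition {n k : ℕ} (M : Matrix (Fin n) (Fin n) ℝ)
    (U : Matrix (Fin n) (Fin k) ℝ) (lam : Fin k → ℝ) : Prop where
  orthonormal : Uᵀ * U = 1
  eq : M = U * Matrix.diagonal lam * Uᵀ
  ne_zero : ∀ i, lam i ≠ 0
  antitone : Antitone (fun i => |lam i|)

/-- The condition number `ψ = |λ₁ / λ_k|` (for `k ≥ 1`). -/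
noncomputable def condNumber {k : ℕ} (lam : Fin k → ℝ) : ℝ :=
  if h : 0 < k then |lam ⟨0, h⟩ / lam ⟨k - 1, Nat.sub_lt h one_pos⟩| else 0

/-- `ϑ = max {1, k̃^{-1/2} (log n)^{1/2}}`. -/
noncomputable def vartheta (n kt : ℕ) : ℝ :=
  max 1 (√(Real.log n) / √(kt : ℝ))

/-- The spectral-norm distance `d₂(U₁, U₂) = inf_W ‖U₁ - U₂ W‖` over orthogonal `W`; here and
below `‖·‖` on matrices is the spectral norm. -/
noncomputable def d2 {n k : ℕ} (U₁ U₂ : Matrix (Fin n) (Fin k) ℝ) : ℝ :=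
  ⨅ W : Matrix.orthogonalGroup (Fin k) ℝ, ‖U₁ - U₂ * (W : Matrix (Fin k) (Fin k) ℝ)‖

/-- The principal angles between the column spaces of `U₁` and `U₂` (both with orthonormal
columns): their cosines are the singular values of `U₁ᵀ U₂`. -/
noncomputable def principalAngle {n k : ℕ} (U₁ U₂ : Matrix (Fin n) (Fin k) ℝ) (i : Fin k) : ℝ :=
  Real.arccos (sv (U₁ᵀ * U₂) i)

/-- `‖sin Θ(U₁, U₂)‖`, where `Θ` is the diagonal matrix of the principal angles. -/
noncomputable def sinThetaNorm {n k : ℕ} (U₁ U₂ : Matrix (Fin n) (Fin k) ℝ) : ℝ :=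
  ‖Matrix.diagonal (fun i => Real.sin (principalAngle U₁ U₂ i))‖

/-- The property `p` holds with probability at least `q` (the set of all `ω` with `p ω` need not be
assumed measurable: it contains an event of probability at least `q`). -/
def WithProbAtLeast {Ω : Type*} [MeasurableSpace Ω] (μ : Measure Ω) (q : ℝ) (p : Ω → Prop) : Prop :=
  ∃ A : Set Ω, MeasurableSet A ∧ q ≤ μ.real A ∧ ∀ ω ∈ A, p ω

/-- `G 0, ..., G (a - 1)` are independent `n × kt` matrices with independent standard normal
entries, and they are jointly independent of the random matrix `E`. -/
structure IsGaussianSketch {Ω : Type*} [MeasurableSpace Ω] (μ : Measure Ω) {n kt a : ℕ}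
    (G : Fin a → Ω → Matrix (Fin n) (Fin kt) ℝ) (E : Ω → Matrix (Fin n) (Fin n) ℝ) : Prop where
  hasLaw : ∀ (b : Fin a) (i : Fin n) (j : Fin kt),
    HasLaw (fun ω => G b ω i j) (gaussianReal 0 1) μ
  indep : iIndepFun (fun (t : Fin a × Fin n × Fin kt) (ω : Ω) => G t.1 ω t.2.1 t.2.2) μ
  indep_noise : IndepFun (fun (ω : Ω) (t : Fin a × Fin n × Fin kt) => G t.1 ω t.2.1 t.2.2)
    (fun (ω : Ω) (t : Fin n × Fin n) => E ω t.1 t.2) μ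

/-- The three regimes for the rank `k` and the sketching dimension `k̃`, with their parameters:
(a) both are fixed, (b) `k` is fixed and `k̃` grows with `n`, (c) `k` grows with `n` and
`k̃ ≥ c_gap k`. -/
inductive SketchRegime : Type
  | bothFixed (k₀ kt₀ : ℕ) : SketchRegime
  | rankFixed (k₀ : ℕ) : SketchRegime
  | rankGrowing (cgap : ℝ) : SketchRegime

/-- The sequences `k` and `kt` (for `k̃`) are in the given regime. -/
def SketchRegime.Holds : SketchRegime → (ℕ → ℕ) → (ℕ → ℕ) → Prop
  | .bothFixed k₀ kt₀, k, kt => ∀ᶠ n in atTop, k n = k₀ ∧ kt n = kt₀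
  | .rankFixed k₀, k, kt => (∀ᶠ n in atTop, k n = k₀) ∧ Tendsto kt atTop atTop
  | .rankGrowing cgap, k, kt => 1 < cgap ∧ Tendsto k atTop atTop ∧
      ∀ᶠ n in atTop, cgap * (k n : ℝ) ≤ (kt n : ℝ)

/-! Write `N = M + E`, `l = |λ_k|`, `ε = E_n` and `p = U Uᵀ`, and work on the event `‖E‖ ≤ ε`. Since
`ψ = o(S_n/E_n)`, eventually `16 ε ≤ l`. Then `N` expands vectors near the range of `U` by at least
`l / 2` per step (`IsPerturbation.cone_pow`), while one application of `N` leaves at most `ε` times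
the input outside that range. Iterating, the residual of `N ^ g v` is at most `ε (4 / l ‖N ^ g v‖ +
(4 ε) ^ (g - 1) ‖v‖)` (`IsPerturbation.norm_pow_le`). A unit combination of the leading singular
vectors is `N ^ g (G u)` with `‖u‖ ≤ 1 / σ_k(N ^ g G)`, so the largest sine is at most `ε (4 / l +
(4 ε) ^ (g - 1) ‖G‖ / σ_k(N ^ g G))`.

It remains to control `‖G‖ / σ_k` for the selected sketch, about whose conditioning nothing is known
directly. If some sketch satisfies `s ‖x‖ ≤ ‖Gᵀ x‖` on the range of `N ^ g U`, then it has `σ_k ≥ s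
(l / 2) ^ g`, and by maximality so has the selected one; its norm is bounded by a Frobenius bound
`√T` valid for all sketches at once. Levels with `T ≤ K n s²` exist (`exists_goodLevels_of_regime`),
so the loss is a factor of order `√n`, which `g - 1 ≥ 1 / (2β)` powers of `E_n / S_n` absorb
(`error_le`). The estimate is proved with `1` in place of `ϑ ≥ 1`.

The levels come from Gaussian estimates on a fixed subspace; independence of `E` and the sketches
allows the random range of `N ^ g U` to be frozen. With aspect ratio bounded away from `1` a single
sketch fails with probability at most `exp (-k̃)`; with `k` and `k̃` fixed, a positive success
probability suffices. As `a_n` is not bounded above, `T` may grow like `log a_n`; a dilation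
argument (`stdGaussian_smul_set_ge`) shows that the best sketch then improves at the same rate. -/

section StdGaussian

/-! ### Standard Gaussian measures: density, norm tails, isometric images, dilations. -/

set_option linter.unusedSectionVars false

variable {H : Type*} [NormedAddCommGroup H] [InnerProductSpace ℝ H] [FiniteDimensional ℝ H]
  [MeasurableSpace H] [BorelSpace H]

/-- The density of the standard Gaussian measure. -/
noncomputable def stdGaussianDensity (H : Type*) [NormedAddCommGroup H] [InnerProductSpace ℝ H]
    (x : H) : ℝ :=
  (2 * Real.pi) ^ (-(Module.finrank ℝ H : ℝ) / 2) * Real.exp (-(1 / 2) * ‖x‖ ^ 2)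

lemma stdGaussianDensity_nonneg (x : H) : 0 ≤ stdGaussianDensity H x := by
  unfold stdGaussianDensity; positivity

lemma measurable_stdGaussianDensity : Measurable (stdGaussianDensity H) := by
  unfold stdGaussianDensity; fun_prop

lemma integrable_exp_neg_mul_sq_norm {b : ℝ} (hb : 0 < b) :
    Integrable (fun x : H => Real.exp (-b * ‖x‖ ^ 2)) := by
  have h := GaussianFourier.integrable_cexp_neg_mul_sq_norm_add (V := H) (b := (b : ℂ))
    (by simpa using hb) 0 0
  have h2 := h.re
  refine h2.congr (Eventually.of_forall fun x => ?_)
  simp only [zero_mul, add_zero]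
  have : (-(b : ℂ) * (‖x‖ : ℂ) ^ 2) = ((-b * ‖x‖ ^ 2 : ℝ) : ℂ) := by push_cast; ring
  rw [this, ← Complex.ofReal_exp]
  exact Complex.ofReal_re _

lemma stdGaussian_eq_withDensity :
    stdGaussian H = volume.withDensity (fun x => ENNReal.ofReal (stdGaussianDensity H x)) := by
  have hint : Integrable (stdGaussianDensity H) :=
    (integrable_exp_neg_mul_sq_norm (by norm_num)).const_mul _
  have : IsFiniteMeasure
      (volume.withDensity (fun x => ENNReal.ofReal (stdGaussianDensity H x))) :=
    isFiniteMeasure_withDensity_ofReal hint.2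
  apply Measure.ext_of_charFun
  ext t
  rw [charFun_stdGaussian, charFun_apply,
    integral_withDensity_eq_integral_toReal_smul
      (measurable_stdGaussianDensity.ennreal_ofReal) (Eventually.of_forall fun x => by simp)]
  have key := GaussianFourier.integral_cexp_neg_mul_sq_norm_add (V := H) (b := (1 / 2 : ℂ))
    (by norm_num) Complex.I t
  have hpi : ((2 * Real.pi : ℝ) : ℂ) = (Real.pi : ℂ) / (1 / 2) := by push_cast; ring
  have e1 : ∀ x : H, (ENNReal.ofReal (stdGaussianDensity H x)).toReal •
      Complex.exp ((inner ℝ x t : ℝ) * Complex.I) =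
      (((2 * Real.pi) ^ (-(Module.finrank ℝ H : ℝ) / 2) : ℝ) : ℂ) *
        Complex.exp (-(1 / 2) * (‖x‖ : ℂ) ^ 2 + Complex.I * (inner ℝ t x : ℝ)) := by
    intro x
    rw [ENNReal.toReal_ofReal (stdGaussianDensity_nonneg x), Complex.real_smul, stdGaussianDensity,
      Complex.exp_add, real_inner_comm]
    push_cast
    ring_nf
  simp_rw [e1]
  rw [integral_const_mul, key, ← hpi, ← mul_assoc, Complex.ofReal_cpow (by positivity),
    ← Complex.cpow_add _ _ (by simp [Real.pi_ne_zero])]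
  have : ((-(Module.finrank ℝ H : ℝ) / 2 : ℝ) : ℂ) + (Module.finrank ℝ H : ℂ) / 2 = 0 := by
    push_cast; ring
  rw [this, Complex.cpow_zero, one_mul]
  congr 1
  rw [Complex.I_sq]; ring

lemma integral_stdGaussian (f : H → ℝ) :
    ∫ x, f x ∂(stdGaussian H) = ∫ x, stdGaussianDensity H x * f x := by
  rw [stdGaussian_eq_withDensity, integral_withDensity_eq_integral_toReal_smul
      (measurable_stdGaussianDensity.ennreal_ofReal) (Eventually.of_forall fun x => by simp)]
  simp [ENNReal.toReal_ofReal (stdGaussianDensity_nonneg _)]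

lemma integrable_exp_mul_sq_norm_stdGaussian {t : ℝ} (ht : t < 1 / 2) :
    Integrable (fun x : H => Real.exp (t * ‖x‖ ^ 2)) (stdGaussian H) := by
  rw [stdGaussian_eq_withDensity, integrable_withDensity_iff_integrable_smul'
    (measurable_stdGaussianDensity.ennreal_ofReal) (Eventually.of_forall fun x => by simp)]
  refine ((integrable_exp_neg_mul_sq_norm (H := H) (b := 1 / 2 - t) (by linarith)).const_mul
    ((2 * Real.pi) ^ (-(Module.finrank ℝ H : ℝ) / 2))).congr (Eventually.of_forall fun x => ?_)
  simp only [smul_eq_mul]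
  rw [ENNReal.toReal_ofReal (stdGaussianDensity_nonneg x), stdGaussianDensity, mul_assoc,
    ← Real.exp_add]
  ring_nf

lemma mgf_sq_norm_stdGaussian {t : ℝ} (ht : t < 1 / 2) :
    mgf (fun x : H => ‖x‖ ^ 2) (stdGaussian H) t =
      (1 - 2 * t) ^ (-(Module.finrank ℝ H : ℝ) / 2) := by
  rw [mgf, integral_stdGaussian]
  have e : ∀ x : H, stdGaussianDensity H x * Real.exp (t * ‖x‖ ^ 2) =
      (2 * Real.pi) ^ (-(Module.finrank ℝ H : ℝ) / 2) * Real.exp (-(1 / 2 - t) * ‖x‖ ^ 2) := by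
    intro x
    rw [stdGaussianDensity, mul_assoc, ← Real.exp_add]; ring_nf
  simp_rw [e]
  rw [integral_const_mul, GaussianFourier.integral_rexp_neg_mul_sq_norm (by linarith)]
  have h1 : Real.pi / (1 / 2 - t) = 2 * Real.pi * (1 - 2 * t)⁻¹ := by
    have : (1 - 2 * t) ≠ 0 := by linarith
    have : (1 / 2 - t) ≠ 0 := by linarith
    field_simp
  rw [h1, Real.mul_rpow (by positivity) (inv_nonneg.2 (by linarith)), ← mul_assoc,
    ← Real.rpow_add (by positivity), Real.inv_rpow (by linarith), ← Real.rpow_neg (by linarith),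
    neg_div]
  simp

lemma stdGaussian_sq_norm_ge_le (t : ℝ) :
    (stdGaussian H).real {x | t ≤ ‖x‖ ^ 2} ≤
      Real.sqrt 2 ^ (Module.finrank ℝ H) * Real.exp (-t / 4) := by
  have h := measure_ge_le_exp_mul_mgf (μ := stdGaussian H) (X := fun x : H => ‖x‖ ^ 2)
    (t := 1 / 4) t (by norm_num) (integrable_exp_mul_sq_norm_stdGaussian (by norm_num))
  rw [mgf_sq_norm_stdGaussian (by norm_num)] at h
  refine h.trans (le_of_eq ?_)
  rw [mul_comm, show -(1 / 4 : ℝ) * t = -t / 4 by ring]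
  congr 1
  rw [show (1 - 2 * (1 / 4) : ℝ) = 2⁻¹ by norm_num, Real.inv_rpow (by norm_num),
    ← Real.rpow_neg (by norm_num), Real.sqrt_eq_rpow, ← Real.rpow_natCast, ← Real.rpow_mul
    (by norm_num)]
  ring_nf

/-- Chernoff bound with a negative parameter. The decay is a full `d`-th power of the radius; this
power is what later beats the volume factor of the parameter space. -/
lemma stdGaussian_norm_le_le {c : ℝ} (hc : 0 < c) :
    (stdGaussian H).real {x | ‖x‖ ^ 2 ≤ 16 * c ^ 2 * Module.finrank ℝ H} ≤
      (8 * c) ^ (Module.finrank ℝ H) := by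
  set d := Module.finrank ℝ H
  -- At this parameter the exponential factor is `exp (1 / 2) ^ d ≤ 2 ^ d`, and dropping the `1` in
  -- the moment generating function leaves `(4 c) ^ d`.
  have h := measure_le_le_exp_mul_mgf (μ := stdGaussian H) (X := fun x : H => ‖x‖ ^ 2)
    (t := -(1 / (32 * c ^ 2))) (16 * c ^ 2 * d) (by simp; positivity)
    (integrable_exp_mul_sq_norm_stdGaussian (lt_of_le_of_lt (b := 0) (by simp; positivity)
      (by norm_num)))
  rw [mgf_sq_norm_stdGaussian (lt_of_le_of_lt (b := 0) (by simp; positivity) (by norm_num))] at h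
  refine h.trans ?_
  have e1 : Real.exp (-(-(1 / (32 * c ^ 2))) * (16 * c ^ 2 * d)) = Real.exp (1 / 2) ^ d := by
    rw [← Real.exp_nat_mul]; congr 1; field_simp; ring
  have e2 : (1 - 2 * (-(1 / (32 * c ^ 2)))) ^ (-(d : ℝ) / 2) ≤ (4 * c) ^ d := by
    have : (4 * c) ^ d = (1 / (16 * c ^ 2)) ^ (-(d : ℝ) / 2) := by
      rw [show 1 / (16 * c ^ 2) = ((4 * c) ^ (2 : ℝ))⁻¹ by
        rw [Real.rpow_two]; field_simp; norm_num, Real.inv_rpow (by positivity),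
        ← Real.rpow_neg (by positivity), ← Real.rpow_mul (by positivity), ← Real.rpow_natCast]
      congr 1; ring
    rw [this]
    apply Real.rpow_le_rpow_of_nonpos (by positivity)
    · have : 2 * (1 / (32 * c ^ 2)) = 1 / (16 * c ^ 2) := by field_simp; norm_num
      linarith
    · have : (0 : ℝ) ≤ d := by positivity
      linarith
  have e3 : Real.exp (1 / 2) ≤ 2 := by
    have := Real.exp_one_lt_d9
    have h2 : Real.exp (1 / 2) ^ 2 = Real.exp 1 := by rw [← Real.exp_nat_mul]; norm_num
    nlinarith [Real.exp_pos (1 / 2)]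
  calc _ ≤ 2 ^ d * (4 * c) ^ d := by
        rw [e1]
        have : 0 ≤ (1 - 2 * (-(1 / (32 * c ^ 2)))) ^ (-(d : ℝ) / 2) :=
          Real.rpow_nonneg (by rw [mul_neg, sub_neg_eq_add]; positivity) _
        gcongr
    _ = (8 * c) ^ d := by rw [← mul_pow]; ring_nf

/-- The characteristic function of the image at `t` is that of the source at `B t`, and it depends
only on the norm. -/
lemma stdGaussian_map_of_norm_adjoint {F : Type*} [NormedAddCommGroup F] [InnerProductSpace ℝ F]
    [FiniteDimensional ℝ F] [MeasurableSpace F] [BorelSpace F] (L : H →L[ℝ] F) (B : F → H)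
    (hB : ∀ x y, inner ℝ (L x) y = inner ℝ x (B y)) (hB' : ∀ y, ‖B y‖ = ‖y‖) :
    (stdGaussian H).map L = stdGaussian F := by
  have : IsProbabilityMeasure ((stdGaussian H).map L) :=
    Measure.isProbabilityMeasure_map L.continuous.aemeasurable
  apply Measure.ext_of_charFun
  ext t
  rw [charFun_apply, integral_map L.continuous.aemeasurable (by fun_prop), charFun_stdGaussian]
  simp_rw [hB]
  rw [← charFun_apply, charFun_stdGaussian, hB']

instance : (stdGaussian H).IsOpenPosMeasure := by
  refine Measure.AbsolutelyContinuous.isOpenPosMeasure (μ := (volume : Measure H)) ?_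
  rw [stdGaussian_eq_withDensity]
  refine withDensity_absolutelyContinuous' measurable_stdGaussianDensity.ennreal_ofReal.aemeasurable
    (Eventually.of_forall fun x => ?_)
  simp only [ne_eq, ENNReal.ofReal_eq_zero, not_le, stdGaussianDensity]
  positivity

-- Compare densities at `x` and `R x`: the ratio is `exp (-(R ^ 2 - 1) ‖x‖ ^ 2 / 2)`, and the
-- Jacobian `R ^ d ≥ 1` can be discarded. It gives a lower bound for the chance of atypically large
-- sketches.
open Pointwise in
lemma stdGaussian_smul_set_ge {S : Set H} (hS : MeasurableSet S) {Q R : ℝ} (hR : 1 ≤ R)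
    (hQ : ∀ x ∈ S, ‖x‖ ^ 2 ≤ Q) :
    Real.exp (-(R ^ 2 * Q / 2)) * (stdGaussian H).real S ≤ (stdGaussian H).real (R • S) := by
  have hR0 : R ≠ 0 := by linarith
  have key : ENNReal.ofReal (Real.exp (-(R ^ 2 * Q / 2))) * stdGaussian H S ≤
      stdGaussian H (R • S) := by
    have hRS : MeasurableSet (R • S) := hS.const_smul_of_ne_zero hR0
    have hmp : Measure.map (fun x : H => R • x) volume =
        ENNReal.ofReal |(R ^ Module.finrank ℝ H)⁻¹| • (volume : Measure H) :=
      Measure.map_addHaar_smul volume hR0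
    have hvol : (volume : Measure H) =
        ENNReal.ofReal (R ^ Module.finrank ℝ H) • Measure.map (fun x : H => R • x) volume := by
      rw [hmp, smul_smul, ← ENNReal.ofReal_mul (by positivity), abs_of_pos (by positivity),
        mul_inv_cancel₀ (by positivity), ENNReal.ofReal_one, one_smul]
    rw [stdGaussian_eq_withDensity, withDensity_apply _ hS, withDensity_apply _ hRS]
    conv_rhs => rw [hvol]
    rw [Measure.restrict_smul, lintegral_smul_measure,
      setLIntegral_map hRS measurable_stdGaussianDensity.ennreal_ofReal (by fun_prop),
      Set.preimage_smul₀ hR0, smul_smul, inv_mul_cancel₀ hR0, one_smul,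
      ← lintegral_const_mul _ measurable_stdGaussianDensity.ennreal_ofReal, smul_eq_mul]
    calc _ ≤ ∫⁻ a in S, ENNReal.ofReal (stdGaussianDensity H (R • a)) := by
          refine setLIntegral_mono' hS fun x hx => ?_
          rw [← ENNReal.ofReal_mul (by positivity)]
          apply ENNReal.ofReal_le_ofReal
          rw [stdGaussianDensity, stdGaussianDensity, mul_left_comm, ← Real.exp_add]
          gcongr
          rw [norm_smul, Real.norm_eq_abs, mul_pow, sq_abs]
          nlinarith [hQ x hx, sq_nonneg ‖x‖, sq_nonneg R]
      _ ≤ _ := by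
          refine le_mul_of_one_le_left (by positivity) ?_
          rw [← ENNReal.ofReal_one]
          exact ENNReal.ofReal_le_ofReal (one_le_pow₀ hR)
  have h2 := ENNReal.toReal_mono (measure_ne_top _ _) key
  rwa [ENNReal.toReal_mul, ENNReal.toReal_ofReal (by positivity)] at h2

end StdGaussian

/-! ### Smallest singular values of Gaussian families. -/

section SmallBall

/-- A Fubini argument replacing nets: if every bad `ω` is bad on a whole ball of parameters, then
the bad event is at most a dimensional factor more likely than for a single parameter. -/
lemma measure_le_of_ball_subset {X Ω : Type*} [NormedAddCommGroup X] [InnerProductSpace ℝ X]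
    [FiniteDimensional ℝ X] [MeasurableSpace X] [BorelSpace X] [MeasurableSpace Ω]
    {P : Measure Ω} [IsProbabilityMeasure P] {A : Set (X × Ω)} (hA : MeasurableSet A)
    {D : Set X} (hD : MeasurableSet D) (hD2 : D ⊆ Metric.closedBall 0 2) {q : ENNReal}
    (hq : ∀ x ∈ D, P {ω | (x, ω) ∈ A} ≤ q) {ρ : ℝ} (hρ : 0 < ρ) {Bad : Set Ω}
    (hBad : ∀ ω ∈ Bad, ∃ x₀, ∀ x ∈ Metric.ball x₀ ρ, x ∈ D ∧ (x, ω) ∈ A) :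
    P Bad ≤ ENNReal.ofReal ((2 / ρ) ^ Module.finrank ℝ X) * q := by
  set k := Module.finrank ℝ X
  set v : ENNReal := (volume : Measure X) (Metric.ball 0 1)
  have hv0 : v ≠ 0 := (Metric.measure_ball_pos _ _ one_pos).ne'
  have hvt : v ≠ ⊤ := measure_ball_lt_top.ne
  -- `f ω` is the volume of parameters at which `ω` is bad. It is at least the volume of a `ρ`-ball
  -- on `Bad`, while its mean is at most `q` times the volume of a ball of radius `2`; Markov's
  -- inequality concludes.
  set f : Ω → ENNReal := fun ω => (volume.restrict D) ((fun x => (x, ω)) ⁻¹' A)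
  have hf : Measurable f := measurable_measure_prodMk_right hA
  have h1 : Bad ⊆ {ω | ENNReal.ofReal (ρ ^ k) * v ≤ f ω} := by
    intro ω hω
    obtain ⟨x₀, hx₀⟩ := hBad ω hω
    have hsub : Metric.ball x₀ ρ ⊆ ((fun x => (x, ω)) ⁻¹' A) ∩ D :=
      fun x hx => ⟨(hx₀ x hx).2, (hx₀ x hx).1⟩
    have : (volume : Measure X) (Metric.ball x₀ ρ) ≤ f ω := by
      refine (measure_mono hsub).trans (le_of_eq ?_)
      exact (Measure.restrict_apply (measurable_prodMk_right hA)).symm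
    rwa [Measure.addHaar_ball_of_pos _ _ hρ] at this
  have h2 : ∫⁻ ω, f ω ∂P ≤ q * (ENNReal.ofReal (2 ^ k) * v) := by
    rw [← Measure.prod_apply_symm hA, Measure.prod_apply hA]
    calc ∫⁻ x in D, P (Prod.mk x ⁻¹' A) ≤ ∫⁻ x in D, q :=
          setLIntegral_mono' hD fun x hx => hq x hx
      _ = q * volume D := by simp
      _ ≤ _ := by
          gcongr
          refine (measure_mono hD2).trans (le_of_eq ?_)
          rw [Measure.addHaar_closedBall _ _ (by norm_num)]
  have h3 := (mul_meas_ge_le_lintegral₀ hf.aemeasurable (ENNReal.ofReal (ρ ^ k) * v)).trans h2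
  have hρk : ENNReal.ofReal (ρ ^ k) ≠ 0 := by
    simp; positivity
  have h4 : ENNReal.ofReal (ρ ^ k) * v * P Bad ≤
      ENNReal.ofReal (ρ ^ k) * v * (ENNReal.ofReal ((2 / ρ) ^ k) * q) := by
    calc _ ≤ _ := mul_le_mul_right (measure_mono h1) _
      _ ≤ _ := h3
      _ = (ENNReal.ofReal (ρ ^ k) * ENNReal.ofReal ((2 / ρ) ^ k)) * v * q := by
          rw [← ENNReal.ofReal_mul (by positivity), ← mul_pow, mul_div_cancel₀ _ hρ.ne']; ring
      _ = _ := by ring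
  exact (ENNReal.mul_le_mul_iff_right (mul_ne_zero hρk hv0)
    (ENNReal.mul_ne_top ENNReal.ofReal_ne_top hvt)).1 h4

variable {X H F : Type*} [NormedAddCommGroup X] [InnerProductSpace ℝ X]
  [FiniteDimensional ℝ X] [MeasurableSpace X] [BorelSpace X]
  [NormedAddCommGroup H] [InnerProductSpace ℝ H] [FiniteDimensional ℝ H]
  [MeasurableSpace H] [BorelSpace H]
  [NormedAddCommGroup F] [InnerProductSpace ℝ F] [FiniteDimensional ℝ F]
  [MeasurableSpace F] [BorelSpace F]

set_option linter.unusedSectionVars false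

/-- A bilinear map which sends a standard Gaussian vector of `H` to `‖x‖` times a standard Gaussian
vector of `F`. -/
def IsGaussianFamily (T : X →L[ℝ] H →L[ℝ] F) : Prop :=
  ∀ x, ‖x‖ = 1 → (stdGaussian H).map (T x) = stdGaussian F

lemma IsGaussianFamily.measureReal_norm_ge_le {T : X →L[ℝ] H →L[ℝ] F} (hT : IsGaussianFamily T)
    {x : X} (hx : ‖x‖ ≤ 2) {t : ℝ} (ht : 0 < t) :
    (stdGaussian H).real {ω | 2 * t ≤ ‖T x ω‖} ≤
      Real.sqrt 2 ^ (Module.finrank ℝ F) * Real.exp (-t ^ 2 / 4) := by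
  by_cases h0 : x = 0
  · have : {ω | 2 * t ≤ ‖T x ω‖} = ∅ := by
      ext ω; simp [h0, ht]
    rw [this]; simp; positivity
  have hx0 : 0 < ‖x‖ := norm_pos_iff.2 h0
  set u : X := (‖x‖)⁻¹ • x
  have hu : ‖u‖ = 1 := by simp [u, norm_smul, hx0.ne']
  refine le_trans ?_ (stdGaussian_sq_norm_ge_le (H := F) (t ^ 2))
  rw [← hT u hu, map_measureReal_apply (T u).continuous.measurable
    (measurableSet_le measurable_const (by fun_prop))]
  refine measureReal_mono (fun ω hω => ?_)
  simp only [Set.mem_ofPred_eq, Set.mem_preimage] at hω ⊢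
  have : ‖T u ω‖ = ‖x‖⁻¹ * ‖T x ω‖ := by simp [u, norm_smul]
  have h2 : t ≤ ‖T u ω‖ := by
    rw [this, ← div_eq_inv_mul, le_div_iff₀ hx0]; nlinarith
  gcongr

lemma IsGaussianFamily.measureReal_norm_le_le {T : X →L[ℝ] H →L[ℝ] F} (hT : IsGaussianFamily T)
    {x : X} (hx : 1 / 2 ≤ ‖x‖) {c : ℝ} (hc : 0 < c) :
    (stdGaussian H).real {ω | ‖T x ω‖ ≤ 2 * (c * √(Module.finrank ℝ F))} ≤
      (8 * c) ^ (Module.finrank ℝ F) := by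
  have hx0 : 0 < ‖x‖ := by linarith
  set u : X := (‖x‖)⁻¹ • x
  have hu : ‖u‖ = 1 := by simp [u, norm_smul, hx0.ne']
  refine le_trans ?_ (stdGaussian_norm_le_le (H := F) hc)
  rw [← hT u hu, map_measureReal_apply (T u).continuous.measurable
    (measurableSet_le (by fun_prop) measurable_const)]
  refine measureReal_mono (fun ω hω => ?_)
  simp only [Set.mem_ofPred_eq, Set.mem_preimage] at hω ⊢
  have : ‖T u ω‖ = ‖x‖⁻¹ * ‖T x ω‖ := by simp [u, norm_smul]
  have h2 : ‖T u ω‖ ≤ 4 * (c * √(Module.finrank ℝ F)) := by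
    rw [this, ← div_eq_inv_mul, div_le_iff₀ hx0]
    have : 0 ≤ c * √(Module.finrank ℝ F) := by positivity
    nlinarith
  calc ‖T u ω‖ ^ 2 ≤ (4 * (c * √(Module.finrank ℝ F))) ^ 2 := by gcongr
    _ = _ := by rw [mul_pow, mul_pow, Real.sq_sqrt (by positivity)]; ring

/-- Since `k ≤ m / γ`, the product is at most `(256 c ^ (1 - 1 / γ)) ^ m`. The exponent of `c` is
positive precisely because `γ > 1`, so a small `c` makes the base equal to `1 / 8`. -/
lemma exists_small_ball_const {γ : ℝ} (hγ : 1 < γ) :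
    ∃ c : ℝ, 0 < c ∧ c ≤ 1 ∧ ∀ k m : ℕ, γ * k ≤ m →
      (8 * c) ^ m * (32 / c) ^ k ≤ (1 / 8) ^ m := by
  set θ : ℝ := 1 - γ⁻¹
  have hγ0 : 0 < γ := by linarith
  have hθ : 0 < θ := by
    have : γ⁻¹ < 1 := inv_lt_one_of_one_lt₀ hγ
    simp [θ, this]
  refine ⟨(1 / 2048) ^ (1 / θ), by positivity,
    Real.rpow_le_one (by norm_num) (by norm_num) (by positivity), fun k m hkm => ?_⟩
  set c : ℝ := (1 / 2048) ^ (1 / θ)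
  have hc : 0 < c := by positivity
  have hc1 : c ≤ 1 := Real.rpow_le_one (by norm_num) (by norm_num) (by positivity)
  have hcθ : c ^ θ = 1 / 2048 := by
    rw [← Real.rpow_mul (by norm_num), one_div_mul_cancel hθ.ne', Real.rpow_one]
  have h32 : 1 ≤ 32 / c := by rw [le_div_iff₀ hc]; linarith
  have hk : (k : ℝ) ≤ γ⁻¹ * m := by
    rw [← div_eq_inv_mul, le_div_iff₀ hγ0]; linarith
  have h1 : (32 / c) ^ k ≤ (32 * (c ^ (γ⁻¹))⁻¹) ^ m := by
    calc (32 / c) ^ k = (32 / c) ^ (k : ℝ) := (Real.rpow_natCast _ _).symm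
      _ ≤ (32 / c) ^ (γ⁻¹ * m) := Real.rpow_le_rpow_of_exponent_le h32 hk
      _ = ((32 / c) ^ γ⁻¹) ^ m := by rw [Real.rpow_mul (by positivity), Real.rpow_natCast]
      _ ≤ _ := by
          gcongr
          rw [Real.div_rpow (by norm_num) hc.le, div_eq_mul_inv]
          gcongr
          calc (32 : ℝ) ^ γ⁻¹ ≤ 32 ^ (1 : ℝ) :=
                Real.rpow_le_rpow_of_exponent_le (by norm_num) (by simp [θ] at hθ; linarith)
            _ = 32 := Real.rpow_one _
  calc _ ≤ (8 * c) ^ m * (32 * (c ^ (γ⁻¹))⁻¹) ^ m := by gcongr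
    _ = (256 * (c * (c ^ (γ⁻¹))⁻¹)) ^ m := by rw [← mul_pow]; ring_nf
    _ = (256 * c ^ θ) ^ m := by
        rw [Real.rpow_sub hc, Real.rpow_one, div_eq_mul_inv]
    _ = _ := by rw [hcθ]; norm_num

/-- The smallest singular value of a Gaussian matrix with aspect ratio bounded away from `1`. -/
lemma exists_smallest_singular_value_bound {γ : ℝ} (hγ : 1 < γ) :
    ∃ c : ℝ, 0 < c ∧ ∀ (X H F : Type) [NormedAddCommGroup X] [InnerProductSpace ℝ X]
      [FiniteDimensional ℝ X] [MeasurableSpace X] [BorelSpace X]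
      [NormedAddCommGroup H] [InnerProductSpace ℝ H] [FiniteDimensional ℝ H]
      [MeasurableSpace H] [BorelSpace H]
      [NormedAddCommGroup F] [InnerProductSpace ℝ F] [FiniteDimensional ℝ F]
      [MeasurableSpace F] [BorelSpace F] (T : X →L[ℝ] H →L[ℝ] F), IsGaussianFamily T →
      1 ≤ Module.finrank ℝ F → γ * Module.finrank ℝ X ≤ Module.finrank ℝ F →
      (stdGaussian H).real {ω | ∀ x, c * √(Module.finrank ℝ F) * ‖x‖ ≤ ‖T x ω‖}ᶜ ≤
        Real.exp (-(Module.finrank ℝ F : ℝ)) := by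
  obtain ⟨c, hc, hc1, hck⟩ := exists_small_ball_const hγ
  refine ⟨c, hc, ?_⟩
  intro X H F _ _ _ _ _ _ _ _ _ _ _ _ _ _ _ T hT hm hkm
  have hk := hck _ _ hkm
  set k := Module.finrank ℝ X
  set m := Module.finrank ℝ F
  have hm0 : (0 : ℝ) < m := by exact_mod_cast hm
  have hsm : 0 < √(m : ℝ) := Real.sqrt_pos.2 hm0
  -- The lower bound needs an upper bound on the operator norm first, so that a near-kernel vector
  -- stays nearly in the kernel on a whole ball.
  set Bad₁ : Set H := {ω | ∃ x, ‖x‖ ≤ 1 ∧ 16 * √(m : ℝ) ≤ ‖T x ω‖}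
  set Bad₂ : Set H := {ω | ω ∉ Bad₁ ∧ ∃ x, ‖T x ω‖ < c * √(m : ℝ) * ‖x‖}
  have hsub : {ω | ∀ x, c * √(m : ℝ) * ‖x‖ ≤ ‖T x ω‖}ᶜ ⊆ Bad₁ ∪ Bad₂ := by
    intro ω hω
    simp only [Set.mem_compl_iff, Set.mem_ofPred_eq, not_forall, not_le] at hω
    by_cases h : ω ∈ Bad₁
    · exact Or.inl h
    · exact Or.inr ⟨h, hω⟩
  have hkm' : k ≤ m := by
    have : (k : ℝ) ≤ m := by
      have : (0 : ℝ) ≤ k := by positivity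
      nlinarith
    exact_mod_cast this
  -- Makes `2 (1 / 8) ^ m ≤ exp (-m)`, so the two bad events fit together in the claimed bound.
  have e2 : (1 / 8 : ℝ) ≤ Real.exp (-2) := by
    have := Real.exp_one_lt_d9
    have h2 : Real.exp 1 ^ 2 = Real.exp 2 := by rw [← Real.exp_nat_mul]; norm_num
    rw [Real.exp_neg, one_div]
    apply inv_anti₀ (Real.exp_pos _)
    rw [← h2]; nlinarith [Real.exp_pos 1]
  have b1 : (stdGaussian H) Bad₁ ≤ ENNReal.ofReal ((1 / 8) ^ m) := by
    have := measure_le_of_ball_subset (P := stdGaussian H)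
      (A := {p : X × H | 2 * (4 * √(m : ℝ)) ≤ ‖T p.1 p.2‖})
      (measurableSet_le measurable_const (by fun_prop)) (D := Metric.closedBall 0 2)
      Metric.isClosed_closedBall.measurableSet subset_rfl
      (q := ENNReal.ofReal (Real.sqrt 2 ^ m * Real.exp (-(4 * √(m : ℝ)) ^ 2 / 4)))
      (fun x hx => by
        rw [← ofReal_measureReal]
        exact ENNReal.ofReal_le_ofReal
          (hT.measureReal_norm_ge_le (by simpa using hx) (by positivity)))
      (ρ := 1 / 2) (by norm_num) (Bad := Bad₁) (fun ω ⟨x, hx, hxω⟩ => by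
        -- Around a maximizer on the unit ball, moving by less than `1 / 2` changes the value by at
        -- most half the maximum, so all of that ball still exceeds `8 √m`.
        obtain ⟨x₀, hx₀, hmax⟩ := (isCompact_closedBall (0 : X) 1).exists_isMaxOn
          ⟨0, by simp⟩ (f := fun x => ‖T x ω‖) (by fun_prop)
        have hN : ∀ y : X, ‖y‖ ≤ 1 → ‖T y ω‖ ≤ ‖T x₀ ω‖ := fun y hy => hmax (by simpa using hy)
        have hx₀1 : ‖x₀‖ ≤ 1 := by simpa using hx₀
        refine ⟨x₀, fun y hy => ?_⟩
        rw [Metric.mem_ball, dist_eq_norm] at hy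
        have h1 : ‖y‖ ≤ ‖y - x₀‖ + ‖x₀‖ := by simpa using norm_add_le (y - x₀) x₀
        refine ⟨by simp; linarith, ?_⟩
        have h2 : 2 * ‖T (y - x₀) ω‖ ≤ ‖T x₀ ω‖ := by
          have := hN ((2 : ℝ) • (y - x₀)) (by rw [norm_smul]; simp; linarith)
          simpa [norm_smul] using this
        have h3 : ‖T x₀ ω‖ ≤ ‖T y ω‖ + ‖T (y - x₀) ω‖ := by
          have := norm_sub_le (T y ω) (T (y - x₀) ω)
          simpa using this
        have h4 := hN x hx
        simp only [Set.mem_ofPred_eq]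
        linarith)
    refine this.trans ?_
    rw [← ENNReal.ofReal_mul (by positivity)]
    apply ENNReal.ofReal_le_ofReal
    have e4 : Real.exp (-(4 * √(m : ℝ)) ^ 2 / 4) = Real.exp (-4) ^ m := by
      rw [← Real.exp_nat_mul, mul_pow, Real.sq_sqrt hm0.le]; ring_nf
    rw [e4]
    calc (2 / (1 / 2) : ℝ) ^ k * (√2 ^ m * Real.exp (-4) ^ m)
        ≤ 4 ^ m * (√2 ^ m * Real.exp (-4) ^ m) := by
          norm_num
          exact mul_le_mul_of_nonneg_right (pow_le_pow_right₀ (by norm_num) hkm') (by positivity)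
      _ = (4 * (√2 * Real.exp (-4))) ^ m := by rw [← mul_pow, ← mul_pow]
      _ ≤ _ := by
          gcongr
          have h1 : √2 ≤ 3 / 2 := by rw [Real.sqrt_le_iff]; norm_num
          have h2 : Real.exp (-4) ≤ 1 / 48 := by
            have := Real.exp_one_gt_d9
            have h2 : Real.exp 1 ^ 4 = Real.exp 4 := by rw [← Real.exp_nat_mul]; norm_num
            rw [Real.exp_neg, one_div]
            apply inv_anti₀ (by norm_num)
            rw [← h2]
            have : (2.7 : ℝ) ^ 4 ≤ Real.exp 1 ^ 4 := by gcongr; linarith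
            refine le_trans (by norm_num) this
          nlinarith [Real.exp_pos (-4), Real.sqrt_nonneg 2]
  have b2 : (stdGaussian H) Bad₂ ≤ ENNReal.ofReal ((1 / 8) ^ m) := by
    have := measure_le_of_ball_subset (P := stdGaussian H)
      (A := {p : X × H | ‖T p.1 p.2‖ ≤ 2 * (c * √(m : ℝ))})
      (measurableSet_le (by fun_prop) measurable_const)
      (D := {x | 1 / 2 ≤ ‖x‖} ∩ {x | ‖x‖ ≤ 2})
      ((measurableSet_le measurable_const (by fun_prop)).inter
        (measurableSet_le (by fun_prop) measurable_const)) (fun x hx => by simpa using hx.2)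
      (q := ENNReal.ofReal ((8 * c) ^ m))
      (fun x hx => by
        rw [← ofReal_measureReal]
        exact ENNReal.ofReal_le_ofReal (hT.measureReal_norm_le_le hx.1 hc))
      (ρ := c / 16) (by positivity) (Bad := Bad₂) (fun ω ⟨hω, x, hx⟩ => by
        -- With this Lipschitz constant, a displacement of at most `c / 16` costs at most `c √m`;
        -- hence the radius `ρ = c / 16` and the level `2 c √m`.
        have hK : ∀ y : X, ‖T y ω‖ ≤ 16 * √(m : ℝ) * ‖y‖ := by
          intro y
          by_cases hy : y = 0
          · simp [hy]
          have hy0 : 0 < ‖y‖ := norm_pos_iff.2 hy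
          by_contra hcon
          apply hω
          refine ⟨‖y‖⁻¹ • y, by simp [norm_smul, hy0.ne'], ?_⟩
          have : ‖T (‖y‖⁻¹ • y) ω‖ = ‖y‖⁻¹ * ‖T y ω‖ := by simp [norm_smul]
          rw [this, ← div_eq_inv_mul, le_div_iff₀ hy0]
          linarith
        have hx0 : 0 < ‖x‖ := by
          rcases (norm_nonneg x).eq_or_lt with h | h
          · rw [← h, mul_zero] at hx; exact absurd hx (not_lt.2 (norm_nonneg _))
          · exact h
        have hu : ‖‖x‖⁻¹ • x‖ = 1 := by simp [norm_smul, hx0.ne']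
        have hTu : ‖T (‖x‖⁻¹ • x) ω‖ ≤ c * √(m : ℝ) := by
          have : ‖T (‖x‖⁻¹ • x) ω‖ = ‖x‖⁻¹ * ‖T x ω‖ := by simp [norm_smul]
          rw [this, ← div_eq_inv_mul, div_le_iff₀ hx0]; exact hx.le
        refine ⟨‖x‖⁻¹ • x, fun y hy => ?_⟩
        set u := ‖x‖⁻¹ • x
        rw [Metric.mem_ball, dist_eq_norm] at hy
        have h1 : ‖y‖ ≤ ‖y - u‖ + ‖u‖ := by simpa using norm_add_le (y - u) u
        have h2 : ‖u‖ ≤ ‖y‖ + ‖y - u‖ := by simpa using norm_sub_le y (y - u)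
        refine ⟨⟨show 1 / 2 ≤ ‖y‖ by linarith, show ‖y‖ ≤ 2 by linarith⟩, ?_⟩
        have h3 : ‖T y ω‖ ≤ ‖T (y - u) ω‖ + ‖T u ω‖ := by
          simpa using norm_add_le (T (y - u) ω) (T u ω)
        have h4 := hK (y - u)
        simp only [Set.mem_ofPred_eq]
        nlinarith)
    refine this.trans ?_
    rw [← ENNReal.ofReal_mul (by positivity)]
    apply ENNReal.ofReal_le_ofReal
    refine le_trans (le_of_eq ?_) hk
    rw [mul_comm]; congr 2; field_simp; norm_num
  have hfin : (stdGaussian H) {ω | ∀ x, c * √(m : ℝ) * ‖x‖ ≤ ‖T x ω‖}ᶜ ≤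
      ENNReal.ofReal (Real.exp (-(m : ℝ))) := by
    calc _ ≤ (stdGaussian H) (Bad₁ ∪ Bad₂) := measure_mono hsub
      _ ≤ _ := measure_union_le _ _
      _ ≤ ENNReal.ofReal ((1 / 8) ^ m) + ENNReal.ofReal ((1 / 8) ^ m) := add_le_add b1 b2
      _ = ENNReal.ofReal ((1 / 8) ^ m + (1 / 8) ^ m) :=
          (ENNReal.ofReal_add (by positivity) (by positivity)).symm
      _ ≤ _ := by
          apply ENNReal.ofReal_le_ofReal
          have h1 : (1 / 8 : ℝ) ^ m ≤ Real.exp (-(m : ℝ)) * Real.exp (-(m : ℝ)) := by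
            rw [← Real.exp_add, show -(m : ℝ) + -(m : ℝ) = m * (-2) by ring, Real.exp_nat_mul]
            gcongr
          have h2 : Real.exp (-(m : ℝ)) ≤ 1 / 2 := by
            calc Real.exp (-(m : ℝ)) ≤ Real.exp (-1) := by
                  apply Real.exp_le_exp.2; simpa using hm
              _ ≤ 1 / 2 := by
                  have := Real.exp_one_gt_d9
                  rw [Real.exp_neg, one_div]
                  exact inv_anti₀ (by norm_num) (by linarith)
          nlinarith [Real.exp_pos (-(m : ℝ))]
  rw [measureReal_def]
  exact ENNReal.toReal_le_of_le_ofReal (by positivity) hfin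

/-- Lower bound for the probability of very large smallest singular values. -/
lemma IsGaussianFamily.smallest_singular_value_scale (T : X →L[ℝ] H →L[ℝ] F) {s Q R : ℝ}
    (hR : 1 ≤ R) :
    Real.exp (-(R ^ 2 * Q / 2)) * ((stdGaussian H).real {ω | ∀ x, s * ‖x‖ ≤ ‖T x ω‖} -
      Real.sqrt 2 ^ (Module.finrank ℝ H) * Real.exp (-Q / 4)) ≤
    (stdGaussian H).real {ω | ∀ x, R * s * ‖x‖ ≤ ‖T x ω‖} := by
  have hcl : IsClosed {ω | ∀ x, s * ‖x‖ ≤ ‖T x ω‖} := by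
    simp_rw [Set.ofPred_forall]
    exact isClosed_iInter fun x => isClosed_le (by fun_prop) (by fun_prop)
  have hcl2 : IsClosed {ω : H | ‖ω‖ ^ 2 ≤ Q} := isClosed_le (by fun_prop) (by fun_prop)
  -- The density comparison needs a bounded set; truncating at `‖ω‖ ^ 2 ≤ Q` costs only the Gaussian
  -- norm tail.
  have h1 := stdGaussian_smul_set_ge (S := {ω | ∀ x, s * ‖x‖ ≤ ‖T x ω‖} ∩ {ω : H | ‖ω‖ ^ 2 ≤ Q})
    (hcl.inter hcl2).measurableSet hR (fun x hx => hx.2)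
  refine (mul_le_mul_of_nonneg_left ?_ (Real.exp_pos _).le).trans (h1.trans ?_)
  · have h2 : {ω | ∀ x, s * ‖x‖ ≤ ‖T x ω‖} ⊆
        ({ω | ∀ x, s * ‖x‖ ≤ ‖T x ω‖} ∩ {ω : H | ‖ω‖ ^ 2 ≤ Q}) ∪ {ω : H | Q ≤ ‖ω‖ ^ 2} := by
      intro ω hω
      rcases le_total (‖ω‖ ^ 2) Q with h | h
      · exact Or.inl ⟨hω, h⟩
      · exact Or.inr h
    have h3 := (measureReal_mono (μ := stdGaussian H) h2).trans (measureReal_union_le _ _)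
    have h4 := stdGaussian_sq_norm_ge_le (H := H) Q
    linarith
  · refine measureReal_mono ?_
    rintro _ ⟨ω, hω, rfl⟩ x
    have := hω.1 x
    simp only [map_smul, norm_smul, Real.norm_eq_abs]
    rw [abs_of_pos (by linarith), mul_assoc]
    gcongr

end SmallBall

/-! ### Gaussian sketching matrices restricted to a subspace. -/

section Sketch

variable (ι κ : Type) [Fintype ι] [Fintype κ]

/-- The bilinear map `(x, G) ↦ Gᵀ x`. -/
noncomputable def transposeMul : EuclideanSpace ℝ ι →L[ℝ] EuclideanSpace ℝ (ι × κ) →L[ℝ]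
    EuclideanSpace ℝ κ :=
  (LinearMap.mk₂ ℝ (fun (x : EuclideanSpace ℝ ι) (G : EuclideanSpace ℝ (ι × κ)) =>
    (WithLp.toLp 2 fun j => ∑ i, x i * G (i, j) : EuclideanSpace ℝ κ))
    (fun x y G => by ext j; simp [add_mul, Finset.sum_add_distrib])
    (fun c x G => by ext j; simp [mul_assoc, Finset.mul_sum])
    (fun x G G' => by ext j; simp [mul_add, Finset.sum_add_distrib])
    (fun c x G => by ext j; simp [mul_left_comm, Finset.mul_sum])).toContinuousBilinearMap

variable {ι κ}

lemma transposeMul_apply (x : EuclideanSpace ℝ ι) (G : EuclideanSpace ℝ (ι × κ)) (j : κ) :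
    transposeMul ι κ x G j = ∑ i, x i * G (i, j) := rfl

/-- The matrix `x yᵀ`. -/
noncomputable def outer (x : EuclideanSpace ℝ ι) (y : EuclideanSpace ℝ κ) :
    EuclideanSpace ℝ (ι × κ) := WithLp.toLp 2 fun p => x p.1 * y p.2

lemma norm_outer (x : EuclideanSpace ℝ ι) (y : EuclideanSpace ℝ κ) :
    ‖outer x y‖ = ‖x‖ * ‖y‖ := by
  rw [← sq_eq_sq₀ (by positivity) (by positivity), mul_pow, EuclideanSpace.real_norm_sq_eq,
    EuclideanSpace.real_norm_sq_eq, EuclideanSpace.real_norm_sq_eq, Finset.sum_mul_sum,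
    Fintype.sum_prod_type]
  simp [outer, mul_pow]

lemma inner_transposeMul (x : EuclideanSpace ℝ ι) (G : EuclideanSpace ℝ (ι × κ))
    (y : EuclideanSpace ℝ κ) :
    inner ℝ (transposeMul ι κ x G) y = inner ℝ G (outer x y) := by
  simp only [PiLp.inner_apply, transposeMul_apply, outer, RCLike.inner_apply, conj_trivial,
    Fintype.sum_prod_type_right, Finset.mul_sum]
  refine Finset.sum_congr rfl fun j _ => Finset.sum_congr rfl fun i _ => by ring

/-- The adjoint of `G ↦ Gᵀ x` is `y ↦ x yᵀ`, an isometry when `x` is a unit vector. -/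
lemma isGaussianFamily_transposeMul : IsGaussianFamily (transposeMul ι κ) := fun x hx =>
  stdGaussian_map_of_norm_adjoint _ (outer x) (inner_transposeMul x)
    (fun y => by rw [norm_outer, hx, one_mul])

lemma isGaussianFamily_transposeMul_subtype (X : Submodule ℝ (EuclideanSpace ℝ ι)) :
    IsGaussianFamily ((transposeMul ι κ).comp X.subtypeL) := fun x hx =>
  isGaussianFamily_transposeMul (x : EuclideanSpace ℝ ι) hx

lemma norm_transposeMul_le (x : EuclideanSpace ℝ ι) (G : EuclideanSpace ℝ (ι × κ)) :
    ‖transposeMul ι κ x G‖ ≤ ‖x‖ * ‖G‖ := by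
  have h1 := inner_transposeMul x G (transposeMul ι κ x G)
  rw [real_inner_self_eq_norm_sq] at h1
  have h2 := real_inner_le_norm G (outer x (transposeMul ι κ x G))
  rw [norm_outer] at h2
  by_contra hcon
  push Not at hcon
  have h3 : 0 < ‖transposeMul ι κ x G‖ := lt_of_le_of_lt (by positivity) hcon
  nlinarith

/-- The probability that all singular values of a Gaussian `j × m` matrix are at least `√m`. -/
noncomputable def fullRankProb (j m : ℕ) : ℝ :=
  (stdGaussian (EuclideanSpace ℝ (Fin j × Fin m))).real
    {A | ∀ x, √(m : ℝ) * ‖x‖ ≤ ‖transposeMul (Fin j) (Fin m) x A‖}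

/-- The event contains a nonempty open ball, and the Gaussian measure charges every such ball. This
also covers the square case `j = m`, where the aspect-ratio bound is unavailable. -/
lemma fullRankProb_pos {j m : ℕ} (hjm : j ≤ m) (hm : 1 ≤ m) : 0 < fullRankProb j m := by
  have hm0 : 0 < √(m : ℝ) := Real.sqrt_pos.2 (by exact_mod_cast hm)
  -- All singular values of this center are `2 √m`, so perturbations of Frobenius norm below `√m`
  -- keep them above `√m`.
  set A₀ : EuclideanSpace ℝ (Fin j × Fin m) :=
    WithLp.toLp 2 fun p => if Fin.castLE hjm p.1 = p.2 then 2 * √(m : ℝ) else 0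
  have hA₀ : ∀ x, ‖transposeMul (Fin j) (Fin m) x A₀‖ = 2 * √(m : ℝ) * ‖x‖ := by
    intro x
    rw [← sq_eq_sq₀ (by positivity) (by positivity), EuclideanSpace.real_norm_sq_eq, mul_pow,
      EuclideanSpace.real_norm_sq_eq, Finset.mul_sum]
    simp_rw [transposeMul_apply]
    have h1 : ∀ i : Fin j, ∑ i', x i' * A₀ (i', Fin.castLE hjm i) = x i * (2 * √(m : ℝ)) := by
      intro i
      rw [Finset.sum_eq_single i]
      · simp [A₀]
      · intro b _ hb
        simp [A₀, (Fin.castLE_injective hjm).eq_iff, hb]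
      · simp
    symm
    apply Finset.sum_of_injOn (Fin.castLE hjm) (Fin.castLE_injective hjm).injOn (by simp)
    · intro l _ hl
      have : ∀ i, A₀ (i, l) = 0 := by
        intro i
        have : Fin.castLE hjm i ≠ l := fun h => hl ⟨i, by simp, h⟩
        simp [A₀, this]
      simp [this]
    · intro i _
      rw [h1]; ring
  have hsub : Metric.ball A₀ √(m : ℝ) ⊆
      {A | ∀ x, √(m : ℝ) * ‖x‖ ≤ ‖transposeMul (Fin j) (Fin m) x A‖} := by
    intro A hA x
    rw [Metric.mem_ball, dist_eq_norm] at hA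
    have h1 := norm_transposeMul_le x (A - A₀)
    have h2 : ‖transposeMul (Fin j) (Fin m) x A₀‖ ≤
        ‖transposeMul (Fin j) (Fin m) x A‖ + ‖transposeMul (Fin j) (Fin m) x (A - A₀)‖ := by
      have := norm_sub_le (transposeMul (Fin j) (Fin m) x A)
        (transposeMul (Fin j) (Fin m) x (A - A₀))
      simpa using this
    rw [hA₀] at h2
    nlinarith [norm_nonneg x]
  have hpos : 0 < (stdGaussian (EuclideanSpace ℝ (Fin j × Fin m))).real
      (Metric.ball A₀ √(m : ℝ)) :=
    ENNReal.toReal_pos (Metric.measure_ball_pos _ _ hm0).ne' (measure_ne_top _ _)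
  exact hpos.trans_le (measureReal_mono hsub)

lemma isClosed_singular_ge {X : Submodule ℝ (EuclideanSpace ℝ ι)} (s : ℝ) :
    IsClosed {A | ∀ x : X, s * ‖x‖ ≤ ‖transposeMul ι κ x A‖} := by
  simp_rw [Set.ofPred_forall]
  exact isClosed_iInter fun x => isClosed_le (by fun_prop) (by fun_prop)

/-- Rotation invariance: in an orthonormal basis of `X`, the restricted sketch is again a standard
Gaussian matrix, of size `dim X × m`. Thus the probability does not depend on `n`. -/
lemma measureReal_singular_eq_fullRankProb {n m : ℕ}
    (X : Submodule ℝ (EuclideanSpace ℝ (Fin n))) :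
    (stdGaussian (EuclideanSpace ℝ (Fin n × Fin m))).real
      {A | ∀ x : X, √(m : ℝ) * ‖x‖ ≤ ‖transposeMul (Fin n) (Fin m) x A‖} =
    fullRankProb (Module.finrank ℝ X) m := by
  set j := Module.finrank ℝ X
  let b : OrthonormalBasis (Fin j) ℝ X := stdOrthonormalBasis ℝ X
  let L : EuclideanSpace ℝ (Fin n × Fin m) →L[ℝ] EuclideanSpace ℝ (Fin j × Fin m) :=
    LinearMap.toContinuousLinearMap
      { toFun := fun G => WithLp.toLp 2 fun p =>
          transposeMul (Fin n) (Fin m) (b p.1 : EuclideanSpace ℝ (Fin n)) G p.2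
        map_add' := fun G G' => by ext p; simp
        map_smul' := fun c G => by ext p; simp }
  have hL : ∀ G p, L G p = transposeMul (Fin n) (Fin m) (b p.1 : EuclideanSpace ℝ (Fin n)) G p.2 :=
    fun G p => rfl
  let B : EuclideanSpace ℝ (Fin j × Fin m) → EuclideanSpace ℝ (Fin n × Fin m) :=
    fun Y => WithLp.toLp 2 fun p =>
      ((∑ a, Y (a, p.2) • b a : X) : EuclideanSpace ℝ (Fin n)) p.1
  have hB : ∀ Y p, B Y p = ∑ a, Y (a, p.2) * (b a : EuclideanSpace ℝ (Fin n)) p.1 := by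
    intro Y p
    change ((∑ a, Y (a, p.2) • b a : X) : EuclideanSpace ℝ (Fin n)) p.1 = _
    simp
  have hmap : (stdGaussian (EuclideanSpace ℝ (Fin n × Fin m))).map L =
      stdGaussian (EuclideanSpace ℝ (Fin j × Fin m)) := by
    apply stdGaussian_map_of_norm_adjoint L B
    · intro G Y
      simp only [PiLp.inner_apply, hL, hB, transposeMul_apply, RCLike.inner_apply, conj_trivial,
        Fintype.sum_prod_type, Finset.mul_sum, Finset.sum_mul]
      calc _ = ∑ c, ∑ a, ∑ i, Y (a, c) * ((b a : EuclideanSpace ℝ (Fin n)) i * G (i, c)) := by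
            rw [Finset.sum_comm]
        _ = ∑ c, ∑ i, ∑ a, Y (a, c) * ((b a : EuclideanSpace ℝ (Fin n)) i * G (i, c)) :=
            Finset.sum_congr rfl fun c _ => Finset.sum_comm
        _ = _ := by
            rw [Finset.sum_comm]
            exact Finset.sum_congr rfl fun i _ => Finset.sum_congr rfl fun c _ =>
              Finset.sum_congr rfl fun a _ => by ring
    · intro Y
      rw [← sq_eq_sq₀ (by positivity) (by positivity), EuclideanSpace.real_norm_sq_eq,
        EuclideanSpace.real_norm_sq_eq, Fintype.sum_prod_type_right, Fintype.sum_prod_type_right]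
      refine Finset.sum_congr rfl fun c _ => ?_
      have h1 : ∑ i, B Y (i, c) ^ 2 = ‖(∑ a, Y (a, c) • b a : X)‖ ^ 2 := by
        rw [Submodule.coe_norm, EuclideanSpace.real_norm_sq_eq]
      rw [h1, ← real_inner_self_eq_norm_sq, b.orthonormal.inner_sum]
      simp [sq]
  rw [fullRankProb, ← hmap, map_measureReal_apply L.continuous.measurable]
  · congr 1
    ext G
    have key : ∀ x : X, transposeMul (Fin n) (Fin m) x G =
        transposeMul (Fin j) (Fin m) (b.repr x) (L G) := by
      intro x
      ext c
      rw [transposeMul_apply, transposeMul_apply]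
      simp_rw [hL, transposeMul_apply, Finset.mul_sum]
      rw [Finset.sum_comm]
      refine Finset.sum_congr rfl fun i _ => ?_
      have : (x : EuclideanSpace ℝ (Fin n)) i =
          ∑ a, b.repr x a * (b a : EuclideanSpace ℝ (Fin n)) i := by
        conv_lhs => rw [← b.sum_repr x]
        simp
      rw [this, Finset.sum_mul]
      exact Finset.sum_congr rfl fun a _ => by ring
    simp only [Set.mem_ofPred_eq, Set.mem_preimage]
    constructor
    · intro h ξ
      have := h (b.repr.symm ξ)
      rwa [key, LinearIsometryEquiv.apply_symm_apply, LinearIsometryEquiv.norm_map] at this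
    · intro h x
      have := h (b.repr x)
      rwa [← key, LinearIsometryEquiv.norm_map] at this
  · simp_rw [Set.ofPred_forall]
    exact (isClosed_iInter fun x => isClosed_le (by fun_prop) (by fun_prop)).measurableSet

end Sketch

/-! ### Repeated sampling: simultaneous levels for the best and the largest sketch. -/

section Sampling

/-- The probability that all singular values of `G` restricted to `X` are at least `s`. -/
noncomputable def singularGeProb {n : ℕ} (m : ℕ) (X : Submodule ℝ (EuclideanSpace ℝ (Fin n)))
    (s : ℝ) : ℝ :=
  (stdGaussian (EuclideanSpace ℝ (Fin n × Fin m))).real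
    {A | ∀ x : X, s * ‖x‖ ≤ ‖transposeMul (Fin n) (Fin m) x A‖}

lemma singularGeProb_le_one {n m : ℕ} (X : Submodule ℝ (EuclideanSpace ℝ (Fin n))) (s : ℝ) :
    singularGeProb m X s ≤ 1 := measureReal_le_one

lemma singularGeProb_scale {n m : ℕ} (X : Submodule ℝ (EuclideanSpace ℝ (Fin n))) {s Q R : ℝ}
    (hR : 1 ≤ R) :
    Real.exp (-(R ^ 2 * Q / 2)) *
      (singularGeProb m X s - √2 ^ (n * m) * Real.exp (-Q / 4)) ≤ singularGeProb m X (R * s) := by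
  have := IsGaussianFamily.smallest_singular_value_scale
    ((transposeMul (Fin n) (Fin m)).comp X.subtypeL) (s := s) (Q := Q) hR
  simpa [singularGeProb] using this

/-- Among the `a` sketches, with failure probability at most `n⁻⁷` for each event, one has its
singular values at least `s` on `X`, and all have squared Frobenius norm at most `T`. -/
def GoodLevels (n k m a : ℕ) (s T : ℝ) : Prop :=
  (∀ X : Submodule ℝ (EuclideanSpace ℝ (Fin n)), Module.finrank ℝ X ≤ k →
    (1 - singularGeProb m X s) ^ a ≤ ((n : ℝ) ^ 7)⁻¹) ∧
  a * (stdGaussian (EuclideanSpace ℝ (Fin n × Fin m))).real {A | T ≤ ‖A‖ ^ 2} ≤ ((n : ℝ) ^ 7)⁻¹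

/-- In the tail bound, `log a` pays for the union over sketches, `7 log n` gives the target
probability, and `n m` absorbs the dimensional factor because `√2 < e`. -/
lemma frobenius_tail {n m a : ℕ} (hn : 1 ≤ n) (ha : 1 ≤ a) :
    a * (stdGaussian (EuclideanSpace ℝ (Fin n × Fin m))).real
      {A | 4 * ((n : ℝ) * m + Real.log a + 7 * Real.log n) ≤ ‖A‖ ^ 2} ≤ ((n : ℝ) ^ 7)⁻¹ := by
  have hn0 : (0 : ℝ) < n := by exact_mod_cast hn
  have ha0 : (0 : ℝ) < a := by exact_mod_cast ha
  have h := stdGaussian_sq_norm_ge_le (H := EuclideanSpace ℝ (Fin n × Fin m))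
    (4 * ((n : ℝ) * m + Real.log a + 7 * Real.log n))
  simp only [finrank_euclideanSpace, Fintype.card_prod, Fintype.card_fin] at h
  have e : Real.exp (-(4 * ((n : ℝ) * m + Real.log a + 7 * Real.log n)) / 4) =
      Real.exp (-1) ^ (n * m) * (a : ℝ)⁻¹ * ((n : ℝ) ^ 7)⁻¹ := by
    rw [← Real.exp_nat_mul, show -(4 * ((n : ℝ) * m + Real.log a + 7 * Real.log n)) / 4 =
      ((n * m : ℕ) : ℝ) * (-1) + -Real.log a + -(((7 : ℕ) : ℝ) * Real.log n) by push_cast; ring,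
      Real.exp_add, Real.exp_add, Real.exp_neg (Real.log a), Real.exp_log ha0,
      Real.exp_neg (((7 : ℕ) : ℝ) * Real.log n), Real.exp_nat_mul, Real.exp_nat_mul,
      Real.exp_log hn0]
  rw [e] at h
  have h2 : √2 * Real.exp (-1) ≤ 1 := by
    have h1 : √2 ≤ 3 / 2 := by rw [Real.sqrt_le_iff]; norm_num
    have := Real.exp_one_gt_d9
    have h3 : Real.exp (-1) ≤ 1 / 2 := by
      rw [Real.exp_neg, one_div]
      exact inv_anti₀ (by norm_num) (by linarith)
    nlinarith [Real.exp_pos (-1), Real.sqrt_nonneg 2]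
  calc _ ≤ (a : ℝ) * (√2 ^ (n * m) *
        (Real.exp (-1) ^ (n * m) * (a : ℝ)⁻¹ * ((n : ℝ) ^ 7)⁻¹)) := by gcongr
    _ = (√2 * Real.exp (-1)) ^ (n * m) * ((n : ℝ) ^ 7)⁻¹ := by
        rw [mul_pow]; field_simp
    _ ≤ 1 * ((n : ℝ) ^ 7)⁻¹ := by
        gcongr
        exact pow_le_one₀ (by positivity) h2
    _ = _ := one_mul _

lemma one_sub_pow_le_exp {p : ℝ} (hp : p ≤ 1) (a : ℕ) : (1 - p) ^ a ≤ Real.exp (-(a * p)) := by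
  calc (1 - p) ^ a ≤ Real.exp (-p) ^ a := by
        refine pow_le_pow_left₀ (by linarith) ?_ a
        have := Real.add_one_le_exp (-p)
        linarith
    _ = _ := by rw [← Real.exp_nat_mul]; ring_nf

lemma exp_neg_seven_log {n : ℕ} (hn : 1 ≤ n) :
    Real.exp (-(7 * Real.log n)) = ((n : ℝ) ^ 7)⁻¹ := by
  have hn0 : (0 : ℝ) < n := by exact_mod_cast hn
  rw [Real.exp_neg, show (7 : ℝ) * Real.log n = ((7 : ℕ) : ℝ) * Real.log n by norm_num,
    Real.exp_nat_mul, Real.exp_log hn0]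

/-- For moderate `a` the Frobenius level is of order `n m`, and `s = c √m` already has the right
ratio. For huge `a` it is of order `log a`, so `s` must be enlarged; the many samples make the rarer
event likely enough. -/
lemma exists_goodLevels {c q : ℝ} (hc : 0 < c) (hq : 0 < q) (hq1 : q ≤ 1) :
    ∃ K : ℝ, 0 < K ∧ ∀ᶠ n : ℕ in atTop, ∀ k m a : ℕ, 1 ≤ m → 1 ≤ a →
      (∀ X : Submodule ℝ (EuclideanSpace ℝ (Fin n)), Module.finrank ℝ X ≤ k →
        q ≤ singularGeProb m X (c * √(m : ℝ)) ∧
        (1 - singularGeProb m X (c * √(m : ℝ))) ^ a ≤ ((n : ℝ) ^ 7)⁻¹) →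
      ∃ s T : ℝ, 0 < s ∧ T ≤ K * n * s ^ 2 ∧ GoodLevels n k m a s T := by
  -- Chosen so that truncating at squared norm `Cq n m` loses probability at most `q / 2`.
  set Cq : ℝ := 4 * (Real.log (2 / q) + 1)
  have hlogq : 0 ≤ Real.log (2 / q) := Real.log_nonneg (by rw [le_div_iff₀ hq]; linarith)
  have hCq : 4 ≤ Cq := by simp only [Cq]; linarith
  refine ⟨36 * Cq / c ^ 2, by positivity, ?_⟩
  have hev : ∀ᶠ n : ℕ in atTop, 7 * Real.log n ≤ Real.exp ((n : ℝ) / 2) * (q / 2) := by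
    have h1 : (fun x : ℝ => Real.log x) =o[atTop] fun x => Real.exp ((1 / 2) * x) := by
      have h0 := isLittleO_pow_exp_pos_mul_atTop 1 (b := 1 / 2) (by norm_num)
      simp only [pow_one] at h0
      exact Real.isLittleO_log_id_atTop.trans h0
    have h2 := (h1.comp_tendsto tendsto_natCast_atTop_atTop).bound
      (c := q / 14) (by positivity)
    filter_upwards [h2] with n hn
    simp only [Function.comp, Real.norm_eq_abs, Real.abs_exp] at hn
    have := (le_abs_self _).trans hn
    rw [show (n : ℝ) / 2 = 1 / 2 * n by ring]
    linarith
  filter_upwards [hev, eventually_ge_atTop 1] with n hn hn1 k m a hm ha hX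
  have hn0 : (1 : ℝ) ≤ n := by exact_mod_cast hn1
  have hm0 : (1 : ℝ) ≤ m := by exact_mod_cast hm
  have ha0 : (1 : ℝ) ≤ a := by exact_mod_cast ha
  have hnm : (1 : ℝ) ≤ n * m := by nlinarith
  have hnm' : (n : ℝ) ≤ n * m := by nlinarith
  have hlogn : Real.log n ≤ n := (Real.log_le_sub_one_of_pos (by linarith)).trans (by linarith)
  have hlogn0 : 0 ≤ Real.log n := Real.log_nonneg hn0
  have hloga0 : 0 ≤ Real.log a := Real.log_nonneg ha0
  have hsm : √(m : ℝ) ^ 2 = m := Real.sq_sqrt (by linarith)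
  have hsm0 : 0 < √(m : ℝ) := Real.sqrt_pos.2 (by linarith)
  rcases le_total (Real.log a) (Cq * (n * m)) with hL | hL
  · refine ⟨c * √(m : ℝ), 4 * ((n : ℝ) * m + Real.log a + 7 * Real.log n), by positivity, ?_,
      fun X hXk => (hX X hXk).2, frobenius_tail hn1 ha⟩
    rw [mul_pow, hsm]
    have : 36 * Cq / c ^ 2 * n * (c ^ 2 * m) = 36 * Cq * (n * m) := by field_simp
    rw [this]
    nlinarith
  -- With this dilation the density loss is exactly `a ^ (-1 / 2)`. The expected number of successes
  -- is then at least `√a q / 2`, and `√a ≥ exp (n / 2)` dominates `7 log n`.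
  · set R : ℝ := √(Real.log a / (Cq * (n * m)))
    have hR2 : R ^ 2 = Real.log a / (Cq * (n * m)) := Real.sq_sqrt (by positivity)
    have hR1 : 1 ≤ R := by
      rw [Real.one_le_sqrt, le_div_iff₀ (by positivity)]; linarith
    have hLn : n * m ≤ Real.log a := by nlinarith
    refine ⟨R * (c * √(m : ℝ)), 4 * ((n : ℝ) * m + Real.log a + 7 * Real.log n), by positivity,
      ?_, fun X hXk => ?_, frobenius_tail hn1 ha⟩
    · rw [mul_pow, mul_pow, hsm, hR2]
      have : 36 * Cq / c ^ 2 * n * (Real.log a / (Cq * (n * m)) * (c ^ 2 * m)) =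
        36 * Real.log a := by field_simp
      rw [this]
      linarith
    · have h1 := singularGeProb_scale (m := m) X (s := c * √(m : ℝ)) (Q := Cq * (n * m)) hR1
      have h2 : √2 ^ (n * m) * Real.exp (-(Cq * (n * m)) / 4) ≤ q / 2 := by
        have e1 : Real.exp (-(Cq * (n * m)) / 4) =
            Real.exp (-1) ^ (n * m) * Real.exp (-Real.log (2 / q) * (n * m)) := by
          rw [← Real.exp_nat_mul, ← Real.exp_add]
          congr 1; push_cast; ring
        have e2 : Real.exp (-Real.log (2 / q) * (n * m)) ≤ q / 2 := by
          calc _ ≤ Real.exp (-Real.log (2 / q)) := by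
                apply Real.exp_le_exp.2; nlinarith
            _ = q / 2 := by
                rw [Real.exp_neg, Real.exp_log (by positivity), inv_div]
        have e3 : √2 * Real.exp (-1) ≤ 1 := by
          have h1 : √2 ≤ 3 / 2 := by rw [Real.sqrt_le_iff]; norm_num
          have := Real.exp_one_gt_d9
          have h3 : Real.exp (-1) ≤ 1 / 2 := by
            rw [Real.exp_neg, one_div]
            exact inv_anti₀ (by norm_num) (by linarith)
          nlinarith [Real.exp_pos (-1), Real.sqrt_nonneg 2]
        rw [e1, ← mul_assoc, ← mul_pow]
        calc _ ≤ 1 * (q / 2) := by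
              gcongr
              exact pow_le_one₀ (by positivity) e3
          _ = _ := one_mul _
      have h3 : Real.exp (-(Real.log a / 2)) * (q / 2) ≤
          singularGeProb m X (R * (c * √(m : ℝ))) := by
        refine le_trans ?_ h1
        have : R ^ 2 * (Cq * (n * m)) / 2 = Real.log a / 2 := by
          rw [hR2]; field_simp
        rw [this]
        gcongr
        linarith [(hX X hXk).1]
      refine (one_sub_pow_le_exp (singularGeProb_le_one _ _) a).trans ?_
      rw [← exp_neg_seven_log hn1]
      apply Real.exp_le_exp.2
      apply neg_le_neg
      calc 7 * Real.log n ≤ Real.exp ((n : ℝ) / 2) * (q / 2) := hn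
        _ ≤ Real.exp (Real.log a / 2) * (q / 2) := by
            gcongr; linarith
        _ = a * (Real.exp (-(Real.log a / 2)) * (q / 2)) := by
            have : (a : ℝ) = Real.exp (Real.log a / 2) * Real.exp (Real.log a / 2) := by
              rw [← Real.exp_add, add_halves, Real.exp_log (by linarith)]
            have h4 : (a : ℝ) * (Real.exp (Real.log a / 2))⁻¹ = Real.exp (Real.log a / 2) := by
              rw [← div_eq_mul_inv, div_eq_iff (Real.exp_pos _).ne']
              exact this
            rw [Real.exp_neg, ← mul_assoc, h4]
        _ ≤ _ := by gcongr

/-- A lower bound, uniform in the dimension, for the probability that a sketch has full rank. -/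
noncomputable def minFullRankProb (k m : ℕ) : ℝ :=
  (Finset.range (k + 1)).inf' (by simp) fun j => fullRankProb j m

lemma minFullRankProb_pos {k m : ℕ} (hk : k ≤ m) (hm : 1 ≤ m) : 0 < minFullRankProb k m := by
  rw [minFullRankProb, Finset.lt_inf'_iff]
  intro j hj
  exact fullRankProb_pos ((Nat.lt_succ_iff.1 (Finset.mem_range.1 hj)).trans hk) hm

lemma minFullRankProb_le {n k m : ℕ} (X : Submodule ℝ (EuclideanSpace ℝ (Fin n)))
    (hX : Module.finrank ℝ X ≤ k) : minFullRankProb k m ≤ singularGeProb m X (1 * √(m : ℝ)) := by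
  rw [one_mul, singularGeProb, measureReal_singular_eq_fullRankProb]
  exact Finset.inf'_le _ (Finset.mem_range.2 (Nat.lt_succ_iff.2 hX))

/-- The constant in the lower bound for the number of repetitions. -/
noncomputable def repetitionConst : SketchRegime → ℝ
  | .bothFixed k₀ kt₀ => if 0 < minFullRankProb k₀ kt₀ then 7 * (kt₀ + 1) / minFullRankProb k₀ kt₀
      else 1
  | .rankFixed _ => 7
  | .rankGrowing _ => 7

lemma repetitionConst_pos (r : SketchRegime) : 0 < repetitionConst r := by
  rcases r with ⟨k₀, kt₀⟩ | _ | _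
  · rw [repetitionConst]; split_ifs <;> positivity
  all_goals norm_num [repetitionConst]

/-- Each sketch fails with probability at most `exp (-k̃)`, so `a k̃ ≥ 7 log n` independent ones all
fail with probability at most `n⁻⁷`; this is where the constant `7` originates. -/
lemma exists_goodLevels_of_aspect {k kt a : ℕ → ℕ} {γ : ℝ} (hγ : 1 < γ)
    (hk : ∀ᶠ n in atTop, 1 ≤ k n ∧ γ * (k n : ℝ) ≤ kt n)
    (ha : ∀ᶠ n in atTop, ⌈7 * (kt n : ℝ)⁻¹ * Real.log n⌉₊ ≤ a n) :
    ∃ K : ℝ, 0 < K ∧ ∀ᶠ n : ℕ in atTop, ∃ s T : ℝ, 0 < s ∧ T ≤ K * n * s ^ 2 ∧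
      GoodLevels n (k n) (kt n) (a n) s T := by
  obtain ⟨c, hc, hcb⟩ := exists_smallest_singular_value_bound hγ
  obtain ⟨K, hK, hev⟩ := exists_goodLevels hc (q := 1 / 2) (by norm_num) (by norm_num)
  refine ⟨K, hK, ?_⟩
  filter_upwards [hev, hk, ha, eventually_ge_atTop 2] with n hn ⟨hk1, hkγ⟩ han hn2
  have hk0 : (1 : ℝ) ≤ k n := by exact_mod_cast hk1
  have hkt0 : (1 : ℝ) ≤ kt n := by nlinarith
  have hkt1 : 1 ≤ kt n := by exact_mod_cast hkt0
  have hlog : 0 < Real.log n := Real.log_pos (by exact_mod_cast hn2)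
  have ha' : 7 * (kt n : ℝ)⁻¹ * Real.log n ≤ a n := (Nat.le_ceil _).trans (by exact_mod_cast han)
  have ha1 : 1 ≤ a n := by
    have : (0 : ℝ) < a n := lt_of_lt_of_le (by positivity) ha'
    exact_mod_cast this
  refine hn (k n) (kt n) (a n) hkt1 ha1 fun X hX => ?_
  have h1 := hcb X (EuclideanSpace ℝ (Fin n × Fin (kt n))) (EuclideanSpace ℝ (Fin (kt n)))
    ((transposeMul (Fin n) (Fin (kt n))).comp X.subtypeL)
    (isGaussianFamily_transposeMul_subtype X) (by simpa using hkt1)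
    (by
      have : (Module.finrank ℝ X : ℝ) ≤ k n := by exact_mod_cast hX
      simp only [finrank_euclideanSpace, Fintype.card_fin]
      nlinarith)
  simp only [finrank_euclideanSpace, Fintype.card_fin] at h1
  change (stdGaussian (EuclideanSpace ℝ (Fin n × Fin (kt n)))).real {A | ∀ x : X,
    c * √(kt n : ℝ) * ‖x‖ ≤ ‖transposeMul (Fin n) (Fin (kt n)) x A‖}ᶜ ≤ _ at h1
  rw [probReal_compl_eq_one_sub (isClosed_singular_ge _).measurableSet] at h1
  change 1 - singularGeProb (kt n) X (c * √(kt n : ℝ)) ≤ _ at h1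
  constructor
  · have : Real.exp (-(kt n : ℝ)) ≤ 1 / 2 := by
      calc Real.exp (-(kt n : ℝ)) ≤ Real.exp (-1) := by
            apply Real.exp_le_exp.2; linarith
        _ ≤ 1 / 2 := by
            have := Real.exp_one_gt_d9
            rw [Real.exp_neg, one_div]
            exact inv_anti₀ (by norm_num) (by linarith)
    linarith
  · calc _ ≤ Real.exp (-(kt n : ℝ)) ^ (a n) :=
          pow_le_pow_left₀ (by linarith [singularGeProb_le_one (m := kt n) X (c * √(kt n : ℝ))])
            h1 _
      _ ≤ Real.exp (-(7 * Real.log n)) := by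
          rw [← Real.exp_nat_mul]
          apply Real.exp_le_exp.2
          have : 7 * Real.log n = kt n * (7 * (kt n : ℝ)⁻¹ * Real.log n) := by field_simp
          rw [this]; nlinarith
      _ = _ := exp_neg_seven_log (by omega)

lemma exists_goodLevels_of_fixed {k kt a : ℕ → ℕ} {k₀ kt₀ : ℕ}
    (hfix : ∀ᶠ n in atTop, k n = k₀ ∧ kt n = kt₀)
    (hk : ∀ᶠ n in atTop, 1 ≤ k n ∧ k n ≤ kt n)
    (ha : ∀ᶠ n in atTop,
      ⌈repetitionConst (.bothFixed k₀ kt₀) * (kt n : ℝ)⁻¹ * Real.log n⌉₊ ≤ a n) :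
    ∃ K : ℝ, 0 < K ∧ ∀ᶠ n : ℕ in atTop, ∃ s T : ℝ, 0 < s ∧ T ≤ K * n * s ^ 2 ∧
      GoodLevels n (k n) (kt n) (a n) s T := by
  obtain ⟨n₀, ⟨h1, h2⟩, h3, h4⟩ := (hfix.and hk).exists
  have hk₀ : k₀ ≤ kt₀ := by omega
  have hkt₀ : 1 ≤ kt₀ := by omega
  have hkt0 : (1 : ℝ) ≤ kt₀ := by exact_mod_cast hkt₀
  set q := minFullRankProb k₀ kt₀ with hqdef
  have hq : 0 < q := minFullRankProb_pos hk₀ hkt₀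
  have hq1 : q ≤ 1 := (minFullRankProb_le (n := 0) ⊥ (by simp)).trans (singularGeProb_le_one _ _)
  have hC : repetitionConst (.bothFixed k₀ kt₀) = 7 * (kt₀ + 1) / q := by
    rw [repetitionConst, if_pos hq]
  obtain ⟨K, hK, hev⟩ := exists_goodLevels one_pos hq hq1
  refine ⟨K, hK, ?_⟩
  filter_upwards [hev, hfix, ha, eventually_ge_atTop 2] with n hn ⟨hk1, hkt⟩ han hn2
  have hlog : 0 < Real.log n := Real.log_pos (by exact_mod_cast hn2)
  rw [hC, hkt] at han
  have ha' : 7 * (kt₀ + 1) / q * (kt₀ : ℝ)⁻¹ * Real.log n ≤ a n :=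
    (Nat.le_ceil _).trans (by exact_mod_cast han)
  have ha'' : 7 * Real.log n ≤ a n * q := by
    refine le_trans ?_ (mul_le_mul_of_nonneg_right ha' hq.le)
    have : 7 * (kt₀ + 1) / q * (kt₀ : ℝ)⁻¹ * Real.log n * q =
        7 * Real.log n * ((kt₀ + 1) / kt₀) := by field_simp
    rw [this]
    refine le_mul_of_one_le_right (by positivity) ?_
    rw [le_div_iff₀ (by linarith)]; linarith
  have ha1 : 1 ≤ a n := by
    have : (0 : ℝ) < a n := by
      by_contra h
      nlinarith
    exact_mod_cast this
  rw [hk1, hkt]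
  refine hn k₀ kt₀ (a n) hkt₀ ha1 fun X hX => ?_
  have hqX := minFullRankProb_le (m := kt₀) X hX
  refine ⟨hqX, ?_⟩
  rw [← exp_neg_seven_log (by omega : 1 ≤ n)]
  refine (one_sub_pow_le_exp (singularGeProb_le_one _ _) _).trans (Real.exp_le_exp.2 ?_)
  have : (0 : ℝ) ≤ a n := by positivity
  nlinarith

lemma exists_goodLevels_of_regime {k kt a : ℕ → ℕ} {r : SketchRegime} (hr : r.Holds k kt)
    (hk : ∀ᶠ n in atTop, 1 ≤ k n ∧ k n ≤ kt n)
    (ha : ∀ᶠ n in atTop, ⌈repetitionConst r * (kt n : ℝ)⁻¹ * Real.log n⌉₊ ≤ a n) :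
    ∃ K : ℝ, 0 < K ∧ ∀ᶠ n : ℕ in atTop, ∃ s T : ℝ, 0 < s ∧ T ≤ K * n * s ^ 2 ∧
      GoodLevels n (k n) (kt n) (a n) s T := by
  rcases r with ⟨k₀, kt₀⟩ | k₀ | γ
  · exact exists_goodLevels_of_fixed hr hk ha
  -- With `k` fixed and `k̃ → ∞`, any ratio above `1` is eventually available.
  · refine exists_goodLevels_of_aspect (γ := 2) (by norm_num) ?_ ha
    filter_upwards [hr.1, hk, hr.2.eventually_ge_atTop (2 * k₀)] with n h1 h2 h3
    refine ⟨h2.1, ?_⟩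
    rw [h1]; exact_mod_cast h3
  · refine exists_goodLevels_of_aspect hr.1 ?_ ha
    filter_upwards [hr.2.2, hk] with n h1 h2
    exact ⟨h2.1, h1⟩

end Sampling

/-! ### Deterministic power iteration under a small perturbation. -/

section PowerIteration

variable {V : Type*} [NormedAddCommGroup V] [NormedSpace ℝ V]

/-- The data of a projection `p` commuting with `M`, such that `M` vanishes on the kernel of `p` and
is bounded below by `l` on its range, and of a perturbation `N` of `M` by at most `ε`. -/
structure IsPerturbation (p M N : V →ₗ[ℝ] V) (l ε : ℝ) : Prop where
  norm_proj_le : ∀ v, ‖p v‖ ≤ ‖v‖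
  norm_sub_proj_le : ∀ v, ‖v - p v‖ ≤ ‖v‖
  proj_apply : ∀ v, p (M v) = M v
  le_norm_apply : ∀ v, l * ‖p v‖ ≤ ‖M v‖
  norm_apply_sub_le : ∀ v, ‖N v - M v‖ ≤ ε * ‖v‖
  eps_nonneg : 0 ≤ ε
  eps_le : 16 * ε ≤ l
  pos : 0 < l

variable {p M N : V →ₗ[ℝ] V} {l ε : ℝ}

/-- The image of `M` lies in the range of `p`, so only the perturbation contributes to the residual.
-/
lemma IsPerturbation.norm_residual_le (h : IsPerturbation p M N l ε) (v : V) :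
    ‖N v - p (N v)‖ ≤ ε * ‖v‖ := by
  have : N v - p (N v) = (N v - M v) - p (N v - M v) := by
    rw [map_sub, h.proj_apply]; abel
  rw [this]
  exact (h.norm_sub_proj_le _).trans (h.norm_apply_sub_le v)

/-- Inside the cone `‖v‖ ≤ 2 ‖p v‖`, hence the projected part of `N v` is at least `(l - 2 ε) ‖p v‖`
and the residual at most `2 ε ‖p v‖`. Invariance of the cone permits iteration. -/
lemma IsPerturbation.cone (h : IsPerturbation p M N l ε) {v : V} (hv : ‖v - p v‖ ≤ ‖p v‖) :
    l / 2 * ‖p v‖ ≤ ‖p (N v)‖ ∧ ‖N v - p (N v)‖ ≤ ‖p (N v)‖ := by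
  have h1 : ‖v‖ ≤ 2 * ‖p v‖ := by
    have := norm_add_le (v - p v) (p v)
    rw [sub_add_cancel] at this; linarith
  have h2 := h.norm_residual_le v
  have h3 : ‖M v‖ ≤ ‖p (N v)‖ + ‖p (N v - M v)‖ := by
    have := _root_.norm_sub_le (p (N v)) (p (N v - M v))
    rw [map_sub, h.proj_apply] at this ⊢
    simpa using this
  have h4 := h.norm_proj_le (N v - M v)
  have h5 := h.norm_apply_sub_le v
  have h6 := h.le_norm_apply v
  have h7 := h.eps_nonneg
  have h8 := h.eps_le
  have h9 : l / 2 * ‖p v‖ ≤ ‖p (N v)‖ := by nlinarith [norm_nonneg (p v)]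
  exact ⟨h9, by nlinarith [norm_nonneg (p v)]⟩

lemma IsPerturbation.cone_pow (h : IsPerturbation p M N l ε) {v : V} (hv : p v = v) (g : ℕ) :
    (l / 2) ^ g * ‖v‖ ≤ ‖p ((N ^ g) v)‖ ∧ ‖(N ^ g) v - p ((N ^ g) v)‖ ≤ ‖p ((N ^ g) v)‖ := by
  induction g with
  | zero => simp [hv]
  | succ g ih =>
    rw [pow_succ' N, Module.End.mul_apply]
    obtain ⟨h1, h2⟩ := h.cone ih.2
    refine ⟨?_, h2⟩
    have := h.pos
    calc (l / 2) ^ (g + 1) * ‖v‖ = l / 2 * ((l / 2) ^ g * ‖v‖) := by ring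
      _ ≤ l / 2 * ‖p ((N ^ g) v)‖ := by gcongr; exact ih.1
      _ ≤ _ := h1

/-- No cone condition is imposed on `v`, as a sketched vector may be almost orthogonal to the
signal. Either an iterate is expanded by `N` at rate comparable to `l`, or it is mostly residual and
hence shrank by a factor of order `ε`. -/
lemma IsPerturbation.norm_pow_le (h : IsPerturbation p M N l ε) (g : ℕ) (hg : g ≠ 0) (v : V) :
    ‖(N ^ g) v - p ((N ^ g) v)‖ ≤ ε * (4 / l * ‖(N ^ g) v‖ + (4 * ε) ^ (g - 1) * ‖v‖) := by
  have hl := h.pos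
  have hε := h.eps_nonneg
  have hεl := h.eps_le
  have key : ∀ j, ‖(N ^ j) v‖ ≤ 4 / l * ‖(N ^ (j + 1)) v‖ + (4 * ε) ^ j * ‖v‖ := by
    intro j
    induction j with
    | zero => simp; positivity
    | succ j ih =>
      set y := (N ^ (j + 1)) v
      have hy1 : (N ^ (j + 1 + 1)) v = N y := by rw [pow_succ' N, Module.End.mul_apply]
      have hy0 : y = N ((N ^ j) v) := by simp only [y]; rw [pow_succ' N, Module.End.mul_apply]
      rw [hy1]
      have h1 : ‖y‖ ≤ ‖p y‖ + ‖y - p y‖ := by simpa using norm_add_le (p y) (y - p y)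
      have h2 : ‖y - p y‖ ≤ ε * ‖(N ^ j) v‖ := by rw [hy0]; exact h.norm_residual_le _
      have h3 : l * ‖p y‖ ≤ ‖N y‖ + ε * ‖y‖ := by
        have h4 := h.le_norm_apply y
        have h5 := h.norm_apply_sub_le y
        have h6 : ‖M y‖ ≤ ‖N y‖ + ‖N y - M y‖ := by
          simpa using norm_sub_le (N y) (N y - M y)
        linarith
      set W := (4 * ε) ^ j * ‖v‖
      have hW : 0 ≤ W := by positivity
      have e1 : (4 * ε) ^ (j + 1) * ‖v‖ = 4 * ε * W := by simp only [W]; ring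
      rw [e1]
      have h7 : l * ‖(N ^ j) v‖ ≤ 4 * ‖y‖ + l * W := by
        have := mul_le_mul_of_nonneg_left ih hl.le
        rwa [mul_add, ← mul_assoc, mul_div_cancel₀ _ hl.ne'] at this
      have h8 : l * ‖y‖ ≤ ‖N y‖ + ε * ‖y‖ + ε * (4 * ‖y‖ + l * W) := by
        have := mul_le_mul_of_nonneg_left h7 hε
        nlinarith
      have h9 : l * ‖y‖ ≤ 4 * ‖N y‖ + l * (4 * ε * W) := by
        nlinarith [norm_nonneg y, norm_nonneg (N y), mul_nonneg hε (mul_nonneg hl.le hW)]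
      have h10 : l * ‖y‖ ≤ l * (4 / l * ‖N y‖ + 4 * ε * W) := by
        rw [mul_add, ← mul_assoc l, mul_div_cancel₀ _ hl.ne']; exact h9
      exact le_of_mul_le_mul_left h10 hl
  obtain ⟨j, rfl⟩ := Nat.exists_eq_succ_of_ne_zero hg
  have h1 : ‖(N ^ (j + 1)) v - p ((N ^ (j + 1)) v)‖ ≤ ε * ‖(N ^ j) v‖ := by
    rw [pow_succ' N, Module.End.mul_apply]; exact h.norm_residual_le _
  exact h1.trans (mul_le_mul_of_nonneg_left (key j) hε)

end PowerIteration

/-! ### Singular values, principal angles and subspace distances. -/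

section SingularValues

open Module

/-- One half of the Courant-Fischer theorem. -/
lemma le_singularValues {E F : Type*} [NormedAddCommGroup E] [InnerProductSpace ℝ E]
    [FiniteDimensional ℝ E] [NormedAddCommGroup F] [InnerProductSpace ℝ F] [FiniteDimensional ℝ F]
    (T : E →ₗ[ℝ] F) {k : ℕ} (hk : 1 ≤ k) (S : Submodule ℝ F) (hS : k ≤ finrank ℝ S) {t : ℝ}
    (h : ∀ v ∈ S, t * ‖v‖ ≤ ‖T.adjoint v‖) : t ≤ T.singularValues (k - 1) := by
  rcases le_or_gt t 0 with ht | ht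
  · exact ht.trans (T.singularValues_nonneg _)
  have hinj : Function.Injective (T.adjoint ∘ₗ S.subtype) := by
    rw [← LinearMap.ker_eq_bot, LinearMap.ker_eq_bot']
    intro v hv
    have := h v v.2
    simp only [LinearMap.comp_apply, Submodule.subtype_apply] at hv
    rw [hv, norm_zero] at this
    have h0 : ‖(v : F)‖ ≤ 0 := by nlinarith
    simpa using h0
  have hkE : k ≤ finrank ℝ E := hS.trans (LinearMap.finrank_le_finrank_of_injective hinj)
  have hkE' : k - 1 < finrank ℝ E := by omega
  set d := finrank ℝ E with hd
  have hsym := T.isSymmetric_adjoint_comp_self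
  set b := hsym.eigenvectorBasis (hd.symm)
  -- A space of dimension at least `k` contains a nonzero `v` on which these `k - 1` functionals
  -- vanish, so `T.adjoint v` is orthogonal to the first `k - 1` right singular vectors.
  let φ : S →ₗ[ℝ] (Fin (k - 1) → ℝ) :=
    LinearMap.pi fun i =>
      ((innerSL ℝ (b ⟨i, by omega⟩)).toLinearMap ∘ₗ T.adjoint ∘ₗ S.subtype)
  have hφ : ¬ Function.Injective φ := fun hinj' => by
    have := LinearMap.finrank_le_finrank_of_injective hinj'
    simp at this
    omega
  rw [← LinearMap.ker_eq_bot, LinearMap.ker_eq_bot'] at hφ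
  push Not at hφ
  obtain ⟨v, hv, hv0⟩ := hφ
  set x := T.adjoint (v : F)
  have hx : ∀ i : Fin d, (i : ℕ) < k - 1 → inner ℝ (b i) x = 0 := by
    intro i hi
    exact congrFun hv ⟨i, hi⟩
  have hvpos : 0 < ‖(v : F)‖ := norm_pos_iff.2 (by simpa using hv0)
  have hx0 : 0 < ‖x‖ := lt_of_lt_of_le (by positivity) (h v v.2)
  have h1 : t * ‖x‖ ≤ ‖T x‖ := by
    have h2 : ‖x‖ ^ 2 = inner ℝ (v : F) (T x) := by
      rw [← LinearMap.adjoint_inner_left, real_inner_self_eq_norm_sq]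
    have h3 := real_inner_le_norm (v : F) (T x)
    have h4 := h v v.2
    change t * ‖(v : F)‖ ≤ ‖x‖ at h4
    have h5 : ‖(v : F)‖ * (t * ‖x‖) ≤ ‖(v : F)‖ * ‖T x‖ := by nlinarith
    exact le_of_mul_le_mul_left h5 hvpos
  have h2 : ‖T x‖ ^ 2 ≤ T.singularValues (k - 1) ^ 2 * ‖x‖ ^ 2 := by
    have e1 : ‖T x‖ ^ 2 = ∑ i, hsym.eigenvalues hd.symm i * inner ℝ (b i) x ^ 2 := by
      rw [← real_inner_self_eq_norm_sq, ← LinearMap.adjoint_inner_right, real_inner_comm,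
        ← b.sum_inner_mul_inner]
      refine Finset.sum_congr rfl fun i _ => ?_
      have : inner ℝ (T.adjoint (T x)) (b i) = hsym.eigenvalues hd.symm i * inner ℝ (b i) x := by
        rw [LinearMap.adjoint_inner_left, ← LinearMap.adjoint_inner_right, real_inner_comm]
        have := hsym.apply_eigenvectorBasis hd.symm i
        simp only [LinearMap.comp_apply] at this
        rw [this, inner_smul_left]; rfl
      rw [this]; ring
    have e2 : ‖x‖ ^ 2 = ∑ i, inner ℝ (b i) x ^ 2 := by
      rw [← real_inner_self_eq_norm_sq, ← b.sum_inner_mul_inner]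
      refine Finset.sum_congr rfl fun i _ => ?_
      rw [real_inner_comm, sq]
    rw [e1, e2, Finset.mul_sum]
    refine Finset.sum_le_sum fun i _ => ?_
    rcases lt_or_ge (i : ℕ) (k - 1) with hi | hi
    · simp [hx i hi]
    · gcongr
      rw [← T.sq_singularValues_fin hd.symm i]
      have := T.singularValues_antitone hi
      have h0 := T.singularValues_nonneg i
      gcongr
  have h3 : (t * ‖x‖) ^ 2 ≤ (T.singularValues (k - 1) * ‖x‖) ^ 2 := by
    rw [mul_pow (T.singularValues (k - 1))]
    exact (pow_le_pow_left₀ (by positivity) h1 2).trans h2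
  have h4 := (sq_le_sq₀ (by positivity) (mul_nonneg (T.singularValues_nonneg _) hx0.le)).1 h3
  exact le_of_mul_le_mul_right h4 hx0

/-- A singular value decomposition of a linear endomorphism. -/
lemma exists_singular_bases {E : Type*} [NormedAddCommGroup E] [InnerProductSpace ℝ E]
    [FiniteDimensional ℝ E] (T : E →ₗ[ℝ] E) {d : ℕ} (hd : finrank ℝ E = d) :
    ∃ b q : OrthonormalBasis (Fin d) ℝ E, ∀ i : Fin d, T (b i) = T.singularValues i • q i := by
  have hsym := T.isSymmetric_adjoint_comp_self
  set b := hsym.eigenvectorBasis hd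
  have hb : ∀ i j, inner ℝ (T (b i)) (T (b j)) = if i = j then T.singularValues j ^ 2 else 0 := by
    intro i j
    rw [← LinearMap.adjoint_inner_right]
    have := hsym.apply_eigenvectorBasis hd j
    simp only [LinearMap.comp_apply] at this
    rw [this, inner_smul_right, T.sq_singularValues_fin hd j,
      orthonormal_iff_ite.1 b.orthonormal i j]
    split_ifs <;> simp
  -- Only the images with nonzero singular value can be normalized; the rest of the left basis is an
  -- arbitrary completion.
  have horth : Orthonormal ℝ (Set.domRestrict {i : Fin d | T.singularValues i ≠ 0}
      (fun i => (T.singularValues i)⁻¹ • T (b i))) := by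
    rw [orthonormal_iff_ite]
    rintro ⟨i, hi⟩ ⟨j, hj⟩
    change inner ℝ ((T.singularValues i)⁻¹ • T (b i)) ((T.singularValues j)⁻¹ • T (b j)) = _
    rw [real_inner_smul_left, real_inner_smul_right, hb]
    simp only [Subtype.mk.injEq]
    by_cases hij : i = j
    · subst hij
      have hi' : T.singularValues i ≠ 0 := hi
      rw [if_pos rfl, if_pos rfl]
      field_simp
    · rw [if_neg hij, if_neg hij, mul_zero, mul_zero]
  obtain ⟨q, hq⟩ := horth.exists_orthonormalBasis_extension_of_card_eq (by simpa using hd)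
  refine ⟨b, q, fun i => ?_⟩
  by_cases hi : T.singularValues i = 0
  · have := hb i i
    rw [if_pos rfl, hi, real_inner_self_eq_norm_sq] at this
    rw [hi, zero_smul]
    simpa using this
  · rw [hq i hi, smul_smul, mul_inv_cancel₀ hi, one_smul]

lemma inner_toEuclideanLin {n m : ℕ} (A : Matrix (Fin n) (Fin m) ℝ) (v : EuclideanSpace ℝ (Fin m))
    (w : EuclideanSpace ℝ (Fin n)) :
    inner ℝ (Matrix.toEuclideanLin A v) w = inner ℝ v (Matrix.toEuclideanLin Aᵀ w) := by
  rw [← Matrix.conjTranspose_eq_transpose_of_trivial, Matrix.toEuclideanLin_conjTranspose_eq_adjoint,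
    LinearMap.adjoint_inner_right]

lemma toEuclideanLin_mul_apply {n m l : ℕ} (A : Matrix (Fin n) (Fin m) ℝ)
    (B : Matrix (Fin m) (Fin l) ℝ) (v : EuclideanSpace ℝ (Fin l)) :
    Matrix.toEuclideanLin (A * B) v = Matrix.toEuclideanLin A (Matrix.toEuclideanLin B v) := by
  rw [Matrix.toEuclideanLin, Matrix.toEuclideanLin, Matrix.toEuclideanLin, Matrix.toLpLin_mul]; rfl

lemma norm_toEuclideanLin_of_orthonormal {n k : ℕ} {U : Matrix (Fin n) (Fin k) ℝ} (hU : Uᵀ * U = 1)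
    (z : EuclideanSpace ℝ (Fin k)) : ‖Matrix.toEuclideanLin U z‖ = ‖z‖ := by
  rw [← sq_eq_sq₀ (by positivity) (by positivity), ← real_inner_self_eq_norm_sq,
    inner_toEuclideanLin, ← toEuclideanLin_mul_apply, hU, Matrix.toLpLin_one,
    LinearMap.id_apply, real_inner_self_eq_norm_sq]

lemma sq_norm_eq_add_of_orthonormal {n k : ℕ} {U : Matrix (Fin n) (Fin k) ℝ} (hU : Uᵀ * U = 1)
    (v : EuclideanSpace ℝ (Fin n)) :
    ‖v‖ ^ 2 = ‖Matrix.toEuclideanLin Uᵀ v‖ ^ 2 + ‖v - Matrix.toEuclideanLin (U * Uᵀ) v‖ ^ 2 := by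
  rw [norm_sub_sq_real, toEuclideanLin_mul_apply, norm_toEuclideanLin_of_orthonormal hU,
    real_inner_comm, inner_toEuclideanLin, real_inner_self_eq_norm_sq]
  ring

lemma norm_toEuclideanLin_transpose_le {n k : ℕ} {U : Matrix (Fin n) (Fin k) ℝ} (hU : Uᵀ * U = 1)
    (v : EuclideanSpace ℝ (Fin n)) : ‖Matrix.toEuclideanLin Uᵀ v‖ ≤ ‖v‖ := by
  rw [← sq_le_sq₀ (by positivity) (by positivity), sq_norm_eq_add_of_orthonormal hU v]
  linarith [sq_nonneg ‖v - Matrix.toEuclideanLin (U * Uᵀ) v‖]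

lemma norm_sub_toEuclideanLin_le {n k : ℕ} {U : Matrix (Fin n) (Fin k) ℝ} (hU : Uᵀ * U = 1)
    (v : EuclideanSpace ℝ (Fin n)) : ‖v - Matrix.toEuclideanLin (U * Uᵀ) v‖ ≤ ‖v‖ := by
  rw [← sq_le_sq₀ (by positivity) (by positivity), sq_norm_eq_add_of_orthonormal hU v]
  linarith [sq_nonneg ‖Matrix.toEuclideanLin Uᵀ v‖]

lemma adjoint_toEuclideanLin {n m : ℕ} (A : Matrix (Fin n) (Fin m) ℝ) :
    (Matrix.toEuclideanLin A).adjoint = Matrix.toEuclideanLin Aᵀ := by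
  rw [← Matrix.toEuclideanLin_conjTranspose_eq_adjoint,
    Matrix.conjTranspose_eq_transpose_of_trivial]

lemma sin_principalAngle {n k : ℕ} (U₁ U₂ : Matrix (Fin n) (Fin k) ℝ) (i : Fin k) :
    Real.sin (principalAngle U₁ U₂ i) = √(1 - sv (U₁ᵀ * U₂) i ^ 2) := Real.sin_arccos _

/-- The spectral norm of `sin Θ` is at most the norm of the residual of the projection. -/
lemma sinThetaNorm_le {n k : ℕ} {U₁ U₂ : Matrix (Fin n) (Fin k) ℝ} (h₁ : U₁ᵀ * U₁ = 1)
    (h₂ : U₂ᵀ * U₂ = 1) {δ : ℝ} (hδ : 0 ≤ δ)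
    (h : ∀ z, ‖Matrix.toEuclideanLin U₁ z -
      Matrix.toEuclideanLin (U₂ * U₂ᵀ) (Matrix.toEuclideanLin U₁ z)‖ ≤ δ * ‖z‖) :
    sinThetaNorm U₁ U₂ ≤ δ := by
  rw [sinThetaNorm, Matrix.l2_opNorm_diagonal, pi_norm_le_iff_of_nonneg hδ]
  intro i
  rw [sin_principalAngle, Real.norm_of_nonneg (Real.sqrt_nonneg _), Real.sqrt_le_left hδ]
  -- For `δ ≥ 1` the claim is trivial; otherwise every cosine is at least `√(1 - δ ^ 2)` by
  -- Courant–Fischer on the whole space.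
  rcases le_or_gt 1 δ with h1 | h1
  · nlinarith [sq_nonneg (sv (U₁ᵀ * U₂) i)]
  have hk : 1 ≤ k := Nat.one_le_iff_ne_zero.2 fun h0 => by subst h0; exact i.elim0
  have hs : √(1 - δ ^ 2) ≤ sv (U₁ᵀ * U₂) (k - 1) := by
    refine le_singularValues _ hk ⊤ (by simp) fun z _ => ?_
    rw [adjoint_toEuclideanLin, Matrix.transpose_mul, Matrix.transpose_transpose,
      toEuclideanLin_mul_apply]
    apply Real.le_sqrt_of_sq_le _ |>.trans_eq (Real.sqrt_sq (norm_nonneg _))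
    rw [mul_pow, Real.sq_sqrt (by nlinarith)]
    have h3 := sq_norm_eq_add_of_orthonormal h₂ (Matrix.toEuclideanLin U₁ z)
    rw [norm_toEuclideanLin_of_orthonormal h₁] at h3
    have h4 := pow_le_pow_left₀ (norm_nonneg _) (h z) 2
    rw [mul_pow] at h4
    linarith
  have hi : sv (U₁ᵀ * U₂) (k - 1) ≤ sv (U₁ᵀ * U₂) i :=
    (Matrix.toEuclideanLin (U₁ᵀ * U₂)).singularValues_antitone (by have := i.2; omega)
  have h5 : 1 - δ ^ 2 ≤ sv (U₁ᵀ * U₂) i ^ 2 := by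
    have h6 := pow_le_pow_left₀ (Real.sqrt_nonneg _) (hs.trans hi) 2
    rwa [Real.sq_sqrt (by nlinarith)] at h6
  linarith

lemma d2_le_sqrt_two_mul_sinThetaNorm {n k : ℕ} {U₁ U₂ : Matrix (Fin n) (Fin k) ℝ}
    (h₁ : U₁ᵀ * U₁ = 1) (h₂ : U₂ᵀ * U₂ = 1) : d2 U₁ U₂ ≤ √2 * sinThetaNorm U₁ U₂ := by
  set T := Matrix.toEuclideanLin (U₁ᵀ * U₂) with hT
  obtain ⟨b, q, hbq⟩ := exists_singular_bases T (finrank_euclideanSpace_fin (𝕜 := ℝ) (n := k))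
  -- The orthogonal Procrustes choice: `w` sends `q i` to `b i`, so `T ∘ w` is positive semidefinite
  -- with eigenvalues the cosines, and `‖(U₁ - U₂ W) z‖ ^ 2 = 2 ∑ (1 - σ_i) z_i ^ 2`.
  let w : EuclideanSpace ℝ (Fin k) ≃ₗᵢ[ℝ] EuclideanSpace ℝ (Fin k) := q.repr.trans b.repr.symm
  set W : Matrix (Fin k) (Fin k) ℝ :=
    Matrix.toEuclideanLin.symm (w : EuclideanSpace ℝ (Fin k) →ₗ[ℝ] EuclideanSpace ℝ (Fin k)) with hW
  have hWw : ∀ z, Matrix.toEuclideanLin W z = w z := by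
    intro z
    rw [hW, LinearEquiv.apply_symm_apply]; rfl
  have hWo : W ∈ Matrix.orthogonalGroup (Fin k) ℝ := by
    rw [Matrix.mem_orthogonalGroup_iff']
    apply Matrix.toEuclideanLin.injective
    refine LinearMap.ext fun z => ext_inner_left ℝ fun y => ?_
    rw [toEuclideanLin_mul_apply, ← inner_toEuclideanLin, hWw, hWw, w.inner_map_map,
      Matrix.toLpLin_one, LinearMap.id_apply]
  have hle : d2 U₁ U₂ ≤ ‖U₁ - U₂ * W‖ :=
    ciInf_le (f := fun W : Matrix.orthogonalGroup (Fin k) ℝ =>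
      ‖U₁ - U₂ * (W : Matrix (Fin k) (Fin k) ℝ)‖)
      ⟨0, by rintro _ ⟨W, rfl⟩; exact norm_nonneg _⟩ ⟨W, hWo⟩
  refine hle.trans ?_
  set σ := sinThetaNorm U₁ U₂
  have hσ : 0 ≤ σ := norm_nonneg _
  -- For a cosine in `[0, 1]`, `1 - cos θ ≤ 1 - cos² θ = sin² θ`.
  have hσi : ∀ i : Fin k, 1 - T.singularValues i ≤ σ ^ 2 := by
    intro i
    have h0 := T.singularValues_nonneg i
    have h1 : T.singularValues i ≤ 1 := by
      have := congrArg norm (hbq i)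
      rw [norm_smul, q.norm_eq_one, mul_one, Real.norm_of_nonneg h0] at this
      rw [← this, hT, toEuclideanLin_mul_apply]
      refine (norm_toEuclideanLin_transpose_le h₁ _).trans ?_
      rw [norm_toEuclideanLin_of_orthonormal h₂, b.norm_eq_one]
    have h2 : √(1 - T.singularValues i ^ 2) ≤ σ := by
      have := norm_le_pi_norm (fun i => Real.sin (principalAngle U₁ U₂ i)) i
      rw [← Matrix.l2_opNorm_diagonal (𝕜 := ℝ), sin_principalAngle,
        Real.norm_of_nonneg (Real.sqrt_nonneg _)] at this
      exact this
    rw [Real.sqrt_le_left hσ] at h2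
    nlinarith
  rw [Matrix.l2_opNorm_def]
  refine ContinuousLinearMap.opNorm_le_bound _ (by positivity) fun z => ?_
  change ‖Matrix.toEuclideanLin (U₁ - U₂ * W) z‖ ≤ _
  rw [map_sub, LinearMap.sub_apply, toEuclideanLin_mul_apply, hWw]
  rw [← sq_le_sq₀ (by positivity) (by positivity), norm_sub_sq_real,
    norm_toEuclideanLin_of_orthonormal h₁, norm_toEuclideanLin_of_orthonormal h₂, w.norm_map,
    inner_toEuclideanLin, ← toEuclideanLin_mul_apply, mul_pow, mul_pow, Real.sq_sqrt (by norm_num)]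
  have hz : ‖z‖ ^ 2 = ∑ i, q.repr z i ^ 2 := by
    rw [← q.repr.norm_map, EuclideanSpace.real_norm_sq_eq]
  have hTz : inner ℝ z (T (w z)) = ∑ i : Fin k, T.singularValues i * q.repr z i ^ 2 := by
    have : w z = ∑ i, q.repr z i • b i := by
      change b.repr.symm (q.repr z) = _
      rw [b.sum_repr_symm]
    rw [this, map_sum, inner_sum]
    refine Finset.sum_congr rfl fun i _ => ?_
    rw [map_smul, hbq, inner_smul_right, inner_smul_right, real_inner_comm, ← q.repr_apply_apply]
    ring
  rw [hTz]
  have : ∑ i : Fin k, (1 - T.singularValues i) * q.repr z i ^ 2 ≤ σ ^ 2 * ∑ i, q.repr z i ^ 2 := by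
    rw [Finset.mul_sum]
    exact Finset.sum_le_sum fun i _ => mul_le_mul_of_nonneg_right (hσi i) (sq_nonneg _)
  simp only [sub_mul, one_mul, Finset.sum_sub_distrib] at this
  rw [← hz] at this
  linarith

end SingularValues

/-! ### Error of the algorithm for fixed noise and sketches. -/

section Deterministic

lemma norm_toEuclideanLin_le {n m : ℕ} (A : Matrix (Fin n) (Fin m) ℝ)
    (v : EuclideanSpace ℝ (Fin m)) : ‖Matrix.toEuclideanLin A v‖ ≤ ‖A‖ * ‖v‖ :=
  Matrix.l2_opNorm_mulVec A v

lemma toEuclideanLin_diagonal_apply {k : ℕ} (d : Fin k → ℝ) (v : EuclideanSpace ℝ (Fin k))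
    (i : Fin k) : Matrix.toEuclideanLin (Matrix.diagonal d) v i = d i * v i := by
  simp [Matrix.toLpLin_apply, Matrix.mulVec_diagonal]

lemma le_norm_toEuclideanLin_diagonal {k : ℕ} {d : Fin k → ℝ} {l : ℝ} (hl : 0 ≤ l)
    (h : ∀ i, l ≤ |d i|) (v : EuclideanSpace ℝ (Fin k)) :
    l * ‖v‖ ≤ ‖Matrix.toEuclideanLin (Matrix.diagonal d) v‖ := by
  rw [← sq_le_sq₀ (by positivity) (by positivity), mul_pow, EuclideanSpace.real_norm_sq_eq,
    EuclideanSpace.real_norm_sq_eq, Finset.mul_sum]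
  refine Finset.sum_le_sum fun i _ => ?_
  rw [toEuclideanLin_diagonal_apply, mul_pow, ← sq_abs (d i)]
  gcongr
  exact h i

variable {n k : ℕ} {M : Matrix (Fin n) (Fin n) ℝ} {U : Matrix (Fin n) (Fin k) ℝ} {lam : Fin k → ℝ}

lemma IsEigendecomposition.norm_le (h : IsEigendecomposition M U lam) {L : ℝ} (hL : 0 ≤ L)
    (hlam : ∀ i, |lam i| ≤ L) : ‖M‖ ≤ L := by
  rw [Matrix.l2_opNorm_def]
  refine ContinuousLinearMap.opNorm_le_bound _ hL fun v => ?_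
  change ‖Matrix.toEuclideanLin M v‖ ≤ _
  rw [h.eq, toEuclideanLin_mul_apply, toEuclideanLin_mul_apply,
    norm_toEuclideanLin_of_orthonormal h.orthonormal]
  refine (norm_toEuclideanLin_le _ _).trans ?_
  gcongr
  · rw [Matrix.l2_opNorm_diagonal, pi_norm_le_iff_of_nonneg hL]
    exact hlam
  · exact norm_toEuclideanLin_transpose_le h.orthonormal v

lemma IsEigendecomposition.isPerturbation (h : IsEigendecomposition M U lam) {l ε : ℝ}
    (hlam : ∀ i, l ≤ |lam i|) {E : Matrix (Fin n) (Fin n) ℝ} (hE : ‖E‖ ≤ ε) (hl : 0 < l)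
    (hεl : 16 * ε ≤ l) :
    IsPerturbation (Matrix.toEuclideanLin (U * Uᵀ)) (Matrix.toEuclideanLin M)
      (Matrix.toEuclideanLin (M + E)) l ε where
  norm_proj_le v := by
    rw [toEuclideanLin_mul_apply, norm_toEuclideanLin_of_orthonormal h.orthonormal]
    exact norm_toEuclideanLin_transpose_le h.orthonormal v
  norm_sub_proj_le v := norm_sub_toEuclideanLin_le h.orthonormal v
  proj_apply v := by
    rw [← toEuclideanLin_mul_apply]
    have : U * Uᵀ * M = M := by
      rw [h.eq]
      calc U * Uᵀ * (U * Matrix.diagonal lam * Uᵀ) = U * (Uᵀ * U) * Matrix.diagonal lam * Uᵀ := by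
            simp only [Matrix.mul_assoc]
        _ = _ := by rw [h.orthonormal, Matrix.mul_one]
    rw [this]
  le_norm_apply v := by
    rw [toEuclideanLin_mul_apply, norm_toEuclideanLin_of_orthonormal h.orthonormal, h.eq,
      toEuclideanLin_mul_apply, toEuclideanLin_mul_apply,
      norm_toEuclideanLin_of_orthonormal h.orthonormal]
    exact le_norm_toEuclideanLin_diagonal hl.le hlam _
  norm_apply_sub_le v := by
    rw [← LinearMap.sub_apply, ← map_sub, add_sub_cancel_left]
    exact (norm_toEuclideanLin_le E v).trans (by gcongr)
  eps_nonneg := (norm_nonneg _).trans hE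
  eps_le := hεl
  pos := hl

lemma toEuclideanLin_pow_apply (A : Matrix (Fin n) (Fin n) ℝ) (g : ℕ)
    (v : EuclideanSpace ℝ (Fin n)) :
    Matrix.toEuclideanLin (A ^ g) v = (Matrix.toEuclideanLin A ^ g) v := by
  rw [Matrix.toEuclideanLin, Matrix.toLpLin_pow]

/-- Courant–Fischer with the range of `U` as test space: by symmetry the adjoint is `Gᵀ (M + E) ^
g`; the power expands by `(l / 2) ^ g`, and `Gᵀ` loses at most the factor `s` on the image. -/
lemma IsEigendecomposition.le_sv (h : IsEigendecomposition M U lam) (hk : 1 ≤ k) {l ε s : ℝ}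
    (hlam : ∀ i, l ≤ |lam i|) {E : Matrix (Fin n) (Fin n) ℝ} (hE : ‖E‖ ≤ ε) (hl : 0 < l)
    (hεl : 16 * ε ≤ l) (hEs : E.IsSymm) {m g : ℕ} (G : Matrix (Fin n) (Fin m) ℝ) (hs : 0 ≤ s)
    (hG : ∀ z, s * ‖Matrix.toEuclideanLin ((M + E) ^ g * U) z‖ ≤
      ‖Matrix.toEuclideanLin Gᵀ (Matrix.toEuclideanLin ((M + E) ^ g * U) z)‖) :
    s * (l / 2) ^ g ≤ sv ((M + E) ^ g * G) (k - 1) := by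
  have hp := h.isPerturbation hlam hE hl hεl
  have hMs : (M + E)ᵀ = M + E := by
    rw [Matrix.transpose_add, hEs.eq, h.eq]
    simp [Matrix.mul_assoc]
  have hinj : Function.Injective (Matrix.toEuclideanLin U) := by
    rw [← LinearMap.ker_eq_bot, LinearMap.ker_eq_bot']
    intro z hz
    have := norm_toEuclideanLin_of_orthonormal h.orthonormal z
    rw [hz, norm_zero] at this
    exact norm_eq_zero.1 this.symm
  refine le_singularValues _ hk (Matrix.toEuclideanLin U).range
    (by rw [LinearMap.finrank_range_of_inj hinj, finrank_euclideanSpace_fin]) ?_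
  rintro _ ⟨z, rfl⟩
  have hpz : Matrix.toEuclideanLin (U * Uᵀ) (Matrix.toEuclideanLin U z) =
      Matrix.toEuclideanLin U z := by
    rw [← toEuclideanLin_mul_apply, Matrix.mul_assoc, h.orthonormal, Matrix.mul_one]
  rw [adjoint_toEuclideanLin, Matrix.transpose_mul, Matrix.transpose_pow, hMs,
    toEuclideanLin_mul_apply]
  have h1 := hG z
  have h2 := (hp.cone_pow hpz g).1.trans (hp.norm_proj_le _)
  rw [← toEuclideanLin_pow_apply] at h2
  rw [toEuclideanLin_mul_apply] at h1
  refine le_trans ?_ h1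
  rw [mul_assoc]
  gcongr

lemma IsLeadingLeftSingular.orthonormal {m : ℕ} {Y : Matrix (Fin n) (Fin m) ℝ}
    {V : Matrix (Fin n) (Fin k) ℝ} (h : IsLeadingLeftSingular Y V) : Vᵀ * V = 1 := by
  obtain ⟨P, Q, hk, ⟨hP, -, -⟩, rfl⟩ := h
  rw [Matrix.mem_orthogonalGroup_iff'] at hP
  ext i j
  have h1 := congrFun (congrFun hP (Fin.castLE hk i)) (Fin.castLE hk j)
  rw [Matrix.mul_apply] at h1
  rw [Matrix.mul_apply]
  simp only [Matrix.transpose_apply, Matrix.submatrix_apply, id_eq] at h1 ⊢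
  refine Eq.trans h1 ?_
  simp [Matrix.one_apply, (Fin.castLE_injective hk).eq_iff]

/-- Leading left singular vectors lie in the range of the matrix, with controlled preimages. -/
lemma IsLeadingLeftSingular.exists_preimage {m : ℕ} {Y : Matrix (Fin n) (Fin m) ℝ}
    {V : Matrix (Fin n) (Fin k) ℝ} (h : IsLeadingLeftSingular Y V) (hkm : k ≤ m) {t : ℝ}
    (ht : 0 < t) (hY : t ≤ sv Y (k - 1)) (z : EuclideanSpace ℝ (Fin k)) :
    ∃ u, Matrix.toEuclideanLin V z = Matrix.toEuclideanLin Y u ∧ ‖u‖ ≤ ‖z‖ / t := by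
  obtain ⟨P, Q, hk, ⟨hP, hQ, hYeq⟩, rfl⟩ := h
  rw [Matrix.mem_orthogonalGroup_iff'] at hQ
  change Qᵀ * Q = 1 at hQ
  have hsv : ∀ j : Fin k, t ≤ sv Y j := fun j =>
    hY.trans ((Matrix.toEuclideanLin Y).singularValues_antitone (by have := j.2; omega))
  set D : Matrix (Fin n) (Fin m) ℝ :=
    Matrix.of (fun (i : Fin n) (j : Fin m) => if (i : ℕ) = (j : ℕ) then sv Y i else 0)
  -- Invert the diagonal factor on the first `k` coordinates, where the singular values are at least
  -- `t`.
  let y : EuclideanSpace ℝ (Fin m) := WithLp.toLp 2 fun j =>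
    if hj : (j : ℕ) < k then z ⟨j, hj⟩ / sv Y j else 0
  refine ⟨Matrix.toEuclideanLin Q y, ?_, ?_⟩
  · rw [← toEuclideanLin_mul_apply, hYeq, Matrix.mul_assoc, hQ, Matrix.mul_one,
      toEuclideanLin_mul_apply]
    have hD : ∀ l : Fin n, Matrix.toEuclideanLin D y l =
        if hl : (l : ℕ) < k then z ⟨l, hl⟩ else 0 := by
      intro l
      change ∑ j, D l j * y j = _
      split_ifs with hl
      · rw [Finset.sum_eq_single (⟨l, by omega⟩ : Fin m)]
        · have : sv Y l ≠ 0 := (ht.trans_le (hsv ⟨l, hl⟩)).ne'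
          simp only [D, y, Matrix.of_apply, if_true, hl, dite_true]
          field_simp
        · intro j _ hj
          have : ¬ ((l : ℕ) = j) := fun h => hj (Fin.ext h.symm)
          simp [D, this]
        · simp
      · refine Finset.sum_eq_zero fun j _ => ?_
        by_cases hlj : (l : ℕ) = j
        · have : ¬ ((j : ℕ) < k) := by omega
          simp [y, this]
        · simp [D, hlj]
    ext i
    change ∑ j, P i (Fin.castLE hk j) * z j = ∑ l, P i l * Matrix.toEuclideanLin D y l
    apply Finset.sum_of_injOn (Fin.castLE hk) (Fin.castLE_injective hk).injOn (by simp)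
    · intro l _ hl
      have : ¬ ((l : ℕ) < k) := fun h => hl ⟨⟨l, h⟩, by simp, by ext; simp⟩
      rw [hD, dif_neg this, mul_zero]
    · intro j _
      rw [hD, dif_pos (by simp)]
      simp
  · rw [norm_toEuclideanLin_of_orthonormal hQ, le_div_iff₀ ht, ← sq_le_sq₀ (by positivity)
      (by positivity), mul_pow, EuclideanSpace.real_norm_sq_eq, EuclideanSpace.real_norm_sq_eq,
      Finset.sum_mul]
    have e : ∑ j : Fin m, y j ^ 2 * t ^ 2 = ∑ i : Fin k, (z i / sv Y i) ^ 2 * t ^ 2 := by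
      symm
      apply Finset.sum_of_injOn (Fin.castLE hkm) (Fin.castLE_injective hkm).injOn (by simp)
      · intro l _ hl
        have : ¬ ((l : ℕ) < k) := fun h => hl ⟨⟨l, h⟩, by simp, by ext; simp⟩
        simp [y, this]
      · intro j _
        simp [y]
    rw [e]
    refine Finset.sum_le_sum fun i _ => ?_
    have h1 := hsv i
    have h2 : 0 < sv Y i := ht.trans_le h1
    rw [div_pow, div_mul_eq_mul_div, div_le_iff₀ (by positivity)]
    gcongr

lemma norm_toEuclideanLin_le_frobenius {m : ℕ} (G : Matrix (Fin n) (Fin m) ℝ)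
    (A : EuclideanSpace ℝ (Fin n × Fin m)) (hA : ∀ i j, A (i, j) = G i j)
    (v : EuclideanSpace ℝ (Fin m)) : ‖Matrix.toEuclideanLin G v‖ ≤ ‖A‖ * ‖v‖ := by
  set w := Matrix.toEuclideanLin G v
  have h1 : ‖w‖ ^ 2 = inner ℝ v (Matrix.toEuclideanLin Gᵀ w) := by
    rw [← inner_toEuclideanLin, real_inner_self_eq_norm_sq]
  have h2 : Matrix.toEuclideanLin Gᵀ w = transposeMul (Fin n) (Fin m) w A := by
    ext j
    rw [transposeMul_apply]
    change ∑ i, G i j * w i = _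
    exact Finset.sum_congr rfl fun i _ => by rw [hA, mul_comm]
  rw [h2] at h1
  have h3 := real_inner_le_norm v (transposeMul (Fin n) (Fin m) w A)
  have h4 := norm_transposeMul_le w A
  by_contra hcon
  push Not at hcon
  have h5 : 0 < ‖w‖ := lt_of_le_of_lt (by positivity) hcon
  nlinarith [norm_nonneg v]

/-- The deterministic error bound. -/
lemma IsEigendecomposition.sinThetaNorm_le (h : IsEigendecomposition M U lam) {l ε : ℝ}
    (hlam : ∀ i, l ≤ |lam i|) {E : Matrix (Fin n) (Fin n) ℝ} (hE : ‖E‖ ≤ ε) (hl : 0 < l)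
    (hεl : 16 * ε ≤ l) {m g : ℕ} (hkm : k ≤ m) (hg : g ≠ 0) {G : Matrix (Fin n) (Fin m) ℝ}
    {V : Matrix (Fin n) (Fin k) ℝ} (hV : IsLeadingLeftSingular ((M + E) ^ g * G) V) {t f : ℝ}
    (ht : 0 < t) (hsv : t ≤ sv ((M + E) ^ g * G) (k - 1)) (hf : 0 ≤ f)
    (hG : ∀ v, ‖Matrix.toEuclideanLin G v‖ ≤ f * ‖v‖) :
    sinThetaNorm V U ≤ ε * (4 / l + (4 * ε) ^ (g - 1) * (f / t)) := by
  have hp := h.isPerturbation hlam hE hl hεl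
  have hε := hp.eps_nonneg
  refine _root_.sinThetaNorm_le hV.orthonormal h.orthonormal (by positivity) fun z => ?_
  obtain ⟨u, hu, hun⟩ := hV.exists_preimage hkm ht hsv z
  have h1 := hp.norm_pow_le g hg (Matrix.toEuclideanLin G u)
  rw [← toEuclideanLin_pow_apply, ← toEuclideanLin_mul_apply, ← hu,
    norm_toEuclideanLin_of_orthonormal hV.orthonormal] at h1
  refine h1.trans ?_
  have h2 : ‖Matrix.toEuclideanLin G u‖ ≤ f / t * ‖z‖ := by
    calc _ ≤ f * ‖u‖ := hG u
      _ ≤ f * (‖z‖ / t) := by gcongr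
      _ = _ := by ring
  calc _ ≤ ε * (4 / l * ‖z‖ + (4 * ε) ^ (g - 1) * (f / t * ‖z‖)) := by gcongr
    _ = _ := by ring

end Deterministic

/-! ### Probability of the good sketching event. -/

section Events

/-- The `b`-th sketching matrix, as a vector of its entries. -/
noncomputable def sketchBlock {n m a : ℕ} (γ : Fin a × Fin n × Fin m → ℝ) (b : Fin a) :
    EuclideanSpace ℝ (Fin n × Fin m) := WithLp.toLp 2 fun p => γ (b, p)

lemma measurable_sketchBlock {n m a : ℕ} (b : Fin a) :
    Measurable fun γ : Fin a × Fin n × Fin m → ℝ => sketchBlock γ b := by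
  unfold sketchBlock; fun_prop

lemma map_sketchBlock {n m a : ℕ} :
    (Measure.pi fun _ : Fin a × Fin n × Fin m => gaussianReal 0 1).map sketchBlock =
      Measure.pi fun _ : Fin a => stdGaussian (EuclideanSpace ℝ (Fin n × Fin m)) := by
  have h1 := Measure.infinitePi_map_curry (ι := Fin a) (κ := Fin n × Fin m)
    (fun _ _ => gaussianReal 0 1)
  simp only [Measure.infinitePi_eq_pi] at h1
  have h2 : (sketchBlock : (Fin a × Fin n × Fin m → ℝ) → Fin a → _) =
      (fun (x : Fin a → Fin n × Fin m → ℝ) b => WithLp.toLp 2 (x b)) ∘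
        (MeasurableEquiv.curry (Fin a) (Fin n × Fin m) ℝ) := rfl
  rw [h2, ← Measure.map_map (by fun_prop) (by fun_prop), h1,
    Measure.pi_map_pi (fun _ => by fun_prop)]
  congr
  funext b
  exact map_pi_eq_stdGaussian

lemma measure_forall_sketchBlock {n m a : ℕ} {S : Set (EuclideanSpace ℝ (Fin n × Fin m))}
    (hS : MeasurableSet S) :
    (Measure.pi fun _ : Fin a × Fin n × Fin m => gaussianReal 0 1)
      {γ | ∀ b, sketchBlock γ b ∈ S} = stdGaussian _ S ^ a := by
  have h1 : {γ : Fin a × Fin n × Fin m → ℝ | ∀ b, sketchBlock γ b ∈ S} =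
      sketchBlock ⁻¹' (Set.univ.pi fun _ => S) := by ext; simp
  rw [h1, ← Measure.map_apply (measurable_pi_iff.2 measurable_sketchBlock)
    (MeasurableSet.univ_pi fun _ => hS), map_sketchBlock, Measure.pi_pi]
  simp

lemma measure_exists_sketchBlock_le {n m a : ℕ} {S : Set (EuclideanSpace ℝ (Fin n × Fin m))}
    (hS : MeasurableSet S) :
    (Measure.pi fun _ : Fin a × Fin n × Fin m => gaussianReal 0 1)
      {γ | ∃ b, sketchBlock γ b ∈ S} ≤ a * stdGaussian _ S := by
  have h1 : {γ : Fin a × Fin n × Fin m → ℝ | ∃ b, sketchBlock γ b ∈ S} =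
      ⋃ b, {γ | sketchBlock γ b ∈ S} := by ext; simp
  rw [h1]
  refine (measure_iUnion_fintype_le _ _).trans ?_
  have h2 : ∀ b : Fin a, (Measure.pi fun _ : Fin a × Fin n × Fin m => gaussianReal 0 1)
      {γ | sketchBlock γ b ∈ S} = stdGaussian _ S := by
    intro b
    have h3 := measurePreserving_eval
      (fun _ : Fin a => stdGaussian (EuclideanSpace ℝ (Fin n × Fin m))) b
    rw [← h3.measure_preimage hS.nullMeasurableSet, ← map_sketchBlock, Measure.map_apply
      (measurable_pi_iff.2 measurable_sketchBlock) (h3.measurable hS)]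
    rfl
  simp [h2]

lemma withProbAtLeast_of_measure_compl_le {Ω : Type*} [MeasurableSpace Ω] {μ : Measure Ω}
    [IsProbabilityMeasure μ] {p : Ω → Prop} {δ : ℝ} (hδ : 0 ≤ δ)
    (h : μ {ω | ¬ p ω} ≤ ENNReal.ofReal δ) : WithProbAtLeast μ (1 - δ) p := by
  refine ⟨(toMeasurable μ {ω | ¬ p ω})ᶜ, (measurableSet_toMeasurable _ _).compl, ?_, ?_⟩
  · rw [probReal_compl_eq_one_sub (measurableSet_toMeasurable _ _), measureReal_def,
      measure_toMeasurable]
    have := ENNReal.toReal_le_of_le_ofReal hδ h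
    linarith
  · intro ω hω
    by_contra hp
    exact hω (subset_toMeasurable _ _ hp)

lemma WithProbAtLeast.measure_compl_le {Ω : Type*} [MeasurableSpace Ω] {μ : Measure Ω}
    [IsProbabilityMeasure μ] {p : Ω → Prop} {δ : ℝ}
    (h : WithProbAtLeast μ (1 - δ) p) : μ {ω | ¬ p ω} ≤ ENNReal.ofReal δ := by
  obtain ⟨A, hA, hδ, hp⟩ := h
  calc μ {ω | ¬ p ω} ≤ μ Aᶜ := measure_mono fun ω hω hA => hω (hp ω hA)
    _ = ENNReal.ofReal (μ.real Aᶜ) := (ofReal_measureReal).symm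
    _ ≤ _ := by
      apply ENNReal.ofReal_le_ofReal
      rw [probReal_compl_eq_one_sub hA]; linarith

variable {n k m a : ℕ}

/-- One of the sketches is well conditioned on the range of `Z`. -/
def sketchGoodSet (Z : (Fin n × Fin n → ℝ) → Matrix (Fin n) (Fin k) ℝ) (m a : ℕ) (s : ℝ) :
    Set ((Fin n × Fin n → ℝ) × (Fin a × Fin n × Fin m → ℝ)) :=
  ⋃ b : Fin a, {q | ∀ z, s * ‖Matrix.toEuclideanLin (Z q.1) z‖ ≤
    ‖transposeMul (Fin n) (Fin m) (Matrix.toEuclideanLin (Z q.1) z) (sketchBlock q.2 b)‖}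

lemma measurableSet_sketchGoodSet {Z : (Fin n × Fin n → ℝ) → Matrix (Fin n) (Fin k) ℝ}
    (hZ : Continuous Z) (s : ℝ) : MeasurableSet (sketchGoodSet Z m a s) := by
  refine MeasurableSet.iUnion fun b => IsClosed.measurableSet ?_
  simp_rw [Set.ofPred_forall]
  refine isClosed_iInter fun z => ?_
  have h1 : Continuous fun q : (Fin n × Fin n → ℝ) × (Fin a × Fin n × Fin m → ℝ) =>
      Matrix.toEuclideanLin (Z q.1) z := by
    simp only [Matrix.toLpLin_apply]
    exact (PiLp.continuous_toLp 2 _).comp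
      ((hZ.comp continuous_fst).matrix_mulVec continuous_const)
  have h2 : Continuous fun q : (Fin n × Fin n → ℝ) × (Fin a × Fin n × Fin m → ℝ) =>
      sketchBlock q.2 b := by
    unfold sketchBlock; fun_prop
  exact isClosed_le (by fun_prop) (by fun_prop)

/-- For frozen noise the range of `Z e` is a deterministic subspace of dimension at most `k`, so the
subspace estimate applies and independence of the blocks gives the power `a`. -/
lemma measure_section_sketchGoodSet_compl_le
    {Z : (Fin n × Fin n → ℝ) → Matrix (Fin n) (Fin k) ℝ} {s T : ℝ} (h : GoodLevels n k m a s T)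
    (e : Fin n × Fin n → ℝ) :
    (Measure.pi fun _ : Fin a × Fin n × Fin m => gaussianReal 0 1)
      (Prod.mk e ⁻¹' (sketchGoodSet Z m a s)ᶜ) ≤ ENNReal.ofReal ((n : ℝ) ^ 7)⁻¹ := by
  set X := (Matrix.toEuclideanLin (Z e)).range
  have hX : Module.finrank ℝ X ≤ k :=
    (LinearMap.finrank_range_le _).trans (by simp)
  set S := {A | ∀ x : X, s * ‖x‖ ≤ ‖transposeMul (Fin n) (Fin m) x A‖}
  have hS : MeasurableSet S := (isClosed_singular_ge s).measurableSet
  have hsub : Prod.mk e ⁻¹' (sketchGoodSet Z m a s)ᶜ ⊆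
      {γ : Fin a × Fin n × Fin m → ℝ | ∀ b, sketchBlock γ b ∈ Sᶜ} := by
    intro γ hγ b hb
    apply hγ
    refine Set.mem_iUnion.2 ⟨b, fun z => ?_⟩
    exact hb ⟨_, LinearMap.mem_range_self _ z⟩
  refine (measure_mono hsub).trans ?_
  rw [measure_forall_sketchBlock hS.compl, ← ofReal_measureReal, probReal_compl_eq_one_sub hS,
    ← ENNReal.ofReal_pow (by linarith [measureReal_le_one (μ := stdGaussian _) (s := S)])]
  exact ENNReal.ofReal_le_ofReal (h.1 X hX)

/-- Independence makes the joint law of noise and sketches a product. Conditioning event is handled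
by Fubini over the noise, with a bound uniform in it; the Frobenius event involves the sketches
alone. -/
lemma IsGaussianSketch.measure_not_le {Ω : Type*} [MeasurableSpace Ω] {μ : Measure Ω}
    [IsProbabilityMeasure μ] {G : Fin a → Ω → Matrix (Fin n) (Fin m) ℝ}
    {E : Ω → Matrix (Fin n) (Fin n) ℝ} (hG : IsGaussianSketch μ G E)
    (hE : ∀ i j, Measurable fun ω => E ω i j) {s T : ℝ} (h : GoodLevels n k m a s T)
    (M : Matrix (Fin n) (Fin n) ℝ) (U : Matrix (Fin n) (Fin k) ℝ) (g : ℕ) :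
    μ {ω | ¬ ((∃ b, ∀ z, s * ‖Matrix.toEuclideanLin ((M + E ω) ^ g * U) z‖ ≤
        ‖Matrix.toEuclideanLin (G b ω)ᵀ (Matrix.toEuclideanLin ((M + E ω) ^ g * U) z)‖) ∧
      ∀ b v, ‖Matrix.toEuclideanLin (G b ω) v‖ ≤ √T * ‖v‖)} ≤
      ENNReal.ofReal ((n : ℝ) ^ 7)⁻¹ + ENNReal.ofReal ((n : ℝ) ^ 7)⁻¹ := by
  set Gf : Ω → (Fin a × Fin n × Fin m → ℝ) := fun ω t => G t.1 ω t.2.1 t.2.2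
  set Ef : Ω → (Fin n × Fin n → ℝ) := fun ω t => E ω t.1 t.2
  have hEf : Measurable Ef := measurable_pi_iff.2 fun t => hE t.1 t.2
  have hlaw : HasLaw Gf (Measure.pi fun _ => gaussianReal 0 1) μ :=
    hG.indep.hasLaw_pi fun t => hG.hasLaw t.1 t.2.1 t.2.2
  have hGf : AEMeasurable Gf μ := hlaw.aemeasurable
  have hjoint : μ.map (fun ω => (Ef ω, Gf ω)) =
      (μ.map Ef).prod (Measure.pi fun _ => gaussianReal 0 1) := by
    rw [(indepFun_iff_map_prod_eq_prod_map_map hEf.aemeasurable hGf).1 hG.indep_noise.symm,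
      hlaw.map_eq]
  have : IsProbabilityMeasure (μ.map Ef) := Measure.isProbabilityMeasure_map hEf.aemeasurable
  let Z : (Fin n × Fin n → ℝ) → Matrix (Fin n) (Fin k) ℝ :=
    fun e => (M + Matrix.of fun i j => e (i, j)) ^ g * U
  have hZ : Continuous Z := by
    have : Continuous fun e : Fin n × Fin n → ℝ => (Matrix.of fun i j => e (i, j)) :=
      continuous_matrix fun i j => by simp; fun_prop
    exact ((continuous_const.add this).pow g).matrix_mul continuous_const
  have hZE : ∀ ω, Z (Ef ω) = (M + E ω) ^ g * U := fun ω => rfl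
  have hblock : ∀ ω b i j, sketchBlock (Gf ω) b (i, j) = G b ω i j := fun ω b i j => rfl
  have hT' : ∀ ω b x, Matrix.toEuclideanLin (G b ω)ᵀ x =
      transposeMul (Fin n) (Fin m) x (sketchBlock (Gf ω) b) := by
    intro ω b x
    ext j
    rw [transposeMul_apply]
    change ∑ i, G b ω i j * x i = _
    exact Finset.sum_congr rfl fun i _ => by rw [hblock, mul_comm]
  have hsub : {ω | ¬ ((∃ b, ∀ z, s * ‖Matrix.toEuclideanLin ((M + E ω) ^ g * U) z‖ ≤
        ‖Matrix.toEuclideanLin (G b ω)ᵀ (Matrix.toEuclideanLin ((M + E ω) ^ g * U) z)‖) ∧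
      ∀ b v, ‖Matrix.toEuclideanLin (G b ω) v‖ ≤ √T * ‖v‖)} ⊆
      (fun ω => (Ef ω, Gf ω)) ⁻¹' (sketchGoodSet Z m a s)ᶜ ∪
        Gf ⁻¹' {γ | ∃ b, sketchBlock γ b ∈ {A | T ≤ ‖A‖ ^ 2}} := by
    intro ω hω
    by_contra hcon
    simp only [Set.mem_union, not_or, Set.mem_preimage, Set.mem_compl_iff, not_not,
      Set.mem_ofPred_eq, not_exists, not_le] at hcon
    obtain ⟨h1, h2⟩ := hcon
    refine hω ⟨?_, fun b v => ?_⟩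
    · obtain ⟨b, hb⟩ := Set.mem_iUnion.1 h1
      refine ⟨b, fun z => ?_⟩
      rw [hT', ← hZE]
      exact hb z
    · refine (norm_toEuclideanLin_le_frobenius (G b ω) _ (hblock ω b) v).trans ?_
      gcongr
      exact Real.le_sqrt_of_sq_le (h2 b).le
  refine (measure_mono hsub).trans ((measure_union_le _ _).trans (add_le_add ?_ ?_))
  · have hD := (measurableSet_sketchGoodSet (m := m) (a := a) hZ s).compl
    rw [← Measure.map_apply_of_aemeasurable (hEf.aemeasurable.prodMk hGf) hD, hjoint,
      Measure.prod_apply hD]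
    calc _ ≤ ∫⁻ _, ENNReal.ofReal ((n : ℝ) ^ 7)⁻¹ ∂(μ.map Ef) :=
          lintegral_mono fun e => measure_section_sketchGoodSet_compl_le h e
      _ = _ := by simp
  · have hS : MeasurableSet {A : EuclideanSpace ℝ (Fin n × Fin m) | T ≤ ‖A‖ ^ 2} :=
      measurableSet_le measurable_const (by fun_prop)
    have hS' : MeasurableSet {γ : Fin a × Fin n × Fin m → ℝ |
        ∃ b, sketchBlock γ b ∈ {A | T ≤ ‖A‖ ^ 2}} := by
      simp_rw [Set.ofPred_exists]
      exact MeasurableSet.iUnion fun b => measurable_sketchBlock b hS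
    rw [← Measure.map_apply_of_aemeasurable hGf hS', hlaw.map_eq]
    refine (measure_exists_sketchBlock_le hS).trans ?_
    rw [← ofReal_measureReal, ← ENNReal.ofReal_natCast, ← ENNReal.ofReal_mul (by positivity)]
    exact ENNReal.ofReal_le_ofReal h.2

end Events

/-! ### Absorbing the dimensional factor and assembling the theorem. -/

section Rate

lemma sqrt_natCast_le_rpow_pow {n g : ℕ} {β : ℝ} (hn : 1 ≤ n) (hβ : 0 < β)
    (hg : 1 + (2 * β)⁻¹ ≤ (g : ℝ)) : √(n : ℝ) ≤ ((n : ℝ) ^ β) ^ (g - 1) := by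
  have hn0 : (1 : ℝ) ≤ n := by exact_mod_cast hn
  have hg1 : 1 ≤ g := by
    have : (0 : ℝ) < (2 * β)⁻¹ := by positivity
    have : (1 : ℝ) ≤ g := by linarith
    exact_mod_cast this
  rw [← Real.rpow_natCast, ← Real.rpow_mul (by linarith), Real.sqrt_eq_rpow]
  apply Real.rpow_le_rpow_of_exponent_le hn0
  rw [Nat.cast_sub hg1]
  have h1 : (2 * β)⁻¹ ≤ g - 1 := by linarith
  have h2 : β * (2 * β)⁻¹ = 1 / 2 := by field_simp
  have := mul_le_mul_of_nonneg_left h1 hβ.le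
  push_cast
  linarith

/-- The error bound in terms of the condition number `L / l`. -/
lemma error_le {n g : ℕ} {l L S ε s T K c β : ℝ} (hn : 1 ≤ n) (hl : 0 < l) (hlL : l ≤ L)
    (hS : 0 < S) (hSL : S ≤ L) (hε : 0 < ε) (hs : 0 < s) (hK : 0 < K) (hc : 0 < c)
    (hβ : 0 < β) (hg : 1 + (2 * β)⁻¹ ≤ (g : ℝ)) (hT : T ≤ K * n * s ^ 2)
    (hSε : c * (n : ℝ) ^ β ≤ S / ε) :
    ε * (4 / l + (4 * ε) ^ (g - 1) * (√T / (s * (l / 2) ^ g))) ≤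
      (4 + 4 ^ (g - 1) * 2 ^ g * √K * (c⁻¹) ^ (g - 1)) * ((L / l) ^ g * (ε / S)) := by
  have hg1 : 1 ≤ g := by
    have : (0 : ℝ) < (2 * β)⁻¹ := by positivity
    have : (1 : ℝ) ≤ g := by linarith
    exact_mod_cast this
  have hψ : 1 ≤ L / l := by rw [le_div_iff₀ hl]; linarith
  have hL : 0 < L := by linarith
  have h1 : 1 / l ≤ (L / l) ^ g * (1 / S) := by
    calc 1 / l = S / l * (1 / S) := by field_simp
      _ ≤ (L / l) * (1 / S) := by gcongr
      _ ≤ (L / l) ^ g * (1 / S) := by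
          gcongr
          exact le_self_pow₀ hψ (by omega)
  have h2 : √T ≤ √K * √(n : ℝ) * s := by
    rw [← Real.sqrt_mul hK.le]
    refine (Real.sqrt_le_sqrt hT).trans (le_of_eq ?_)
    rw [Real.sqrt_mul (by positivity), Real.sqrt_sq hs.le]
  -- The lower bound on `g` enters here: the signal-to-noise ratio to the power `g - 1` dominates
  -- `√n`, cancelling `ε ^ (g - 1)` in the second error term.
  have h3 : √(n : ℝ) ≤ (S / ε * c⁻¹) ^ (g - 1) := by
    refine (sqrt_natCast_le_rpow_pow hn hβ hg).trans ?_
    gcongr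
    rw [← div_eq_mul_inv, le_div_iff₀ hc]; linarith
  have h4 : √T / (s * (l / 2) ^ g) ≤ √K * (S / ε * c⁻¹) ^ (g - 1) * (2 ^ g / l ^ g) := by
    rw [div_le_iff₀ (by positivity)]
    calc √T ≤ √K * (S / ε * c⁻¹) ^ (g - 1) * s := by
          refine h2.trans ?_; gcongr
      _ = _ := by rw [div_pow]; field_simp
  have h5 : (4 * ε) ^ (g - 1) * (√T / (s * (l / 2) ^ g)) ≤
      4 ^ (g - 1) * 2 ^ g * √K * (c⁻¹) ^ (g - 1) * ((L / l) ^ g * (1 / S)) := by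
    calc _ ≤ (4 * ε) ^ (g - 1) * (√K * (S / ε * c⁻¹) ^ (g - 1) * (2 ^ g / l ^ g)) := by gcongr
      _ = 4 ^ (g - 1) * 2 ^ g * √K * (c⁻¹) ^ (g - 1) * (S ^ (g - 1) / l ^ g) := by
          rw [mul_pow, mul_pow, div_pow]; field_simp
      _ ≤ _ := by
          gcongr
          obtain ⟨j, rfl⟩ : ∃ j, g = j + 1 := ⟨g - 1, by omega⟩
          rw [Nat.add_sub_cancel]
          calc S ^ j / l ^ (j + 1) = (S / l) ^ (j + 1) * (1 / S) := by
                rw [div_pow]; field_simp; ring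
            _ ≤ _ := by gcongr
  calc _ ≤ ε * (4 * ((L / l) ^ g * (1 / S)) +
        4 ^ (g - 1) * 2 ^ g * √K * (c⁻¹) ^ (g - 1) * ((L / l) ^ g * (1 / S))) := by
        have : 4 / l = 4 * (1 / l) := by ring
        rw [this]
        gcongr
    _ = _ := by ring

end Rate

lemma IsEigendecomposition.abs_last_le {n k : ℕ} {M : Matrix (Fin n) (Fin n) ℝ}
    {U : Matrix (Fin n) (Fin k) ℝ} {lam : Fin k → ℝ} (h : IsEigendecomposition M U lam)
    (hk : 0 < k) (i : Fin k) : |lam ⟨k - 1, Nat.sub_lt hk one_pos⟩| ≤ |lam i| :=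
  h.antitone (by rw [Fin.le_def]; have := i.2; simp; omega)

lemma IsEigendecomposition.abs_le_first {n k : ℕ} {M : Matrix (Fin n) (Fin n) ℝ}
    {U : Matrix (Fin n) (Fin k) ℝ} {lam : Fin k → ℝ} (h : IsEigendecomposition M U lam)
    (hk : 0 < k) (i : Fin k) : |lam i| ≤ |lam ⟨0, hk⟩| :=
  h.antitone (by rw [Fin.le_def]; simp)

theorem theorem2 :
    -- The constant `C` depends only on the regime: on `(k, k̃)` in (a), it is at most `15` in (b),
    -- and it depends on `c_gap` in (c).
    ∃ C : SketchRegime → ℝ, (∀ r, 0 < C r) ∧ (∀ k₀, C (.rankFixed k₀) ≤ 15) ∧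
    ∀ (r : SketchRegime) (k kt a : ℕ → ℕ),
      r.Holds k kt →
      (∀ᶠ n in atTop, 1 ≤ k n ∧ k n ≤ kt n) →
      (∀ᶠ n in atTop, ⌈C r * (kt n : ℝ)⁻¹ * Real.log n⌉₊ ≤ a n) →
    ∀ (Ω : ℕ → Type*) [∀ n, MeasurableSpace (Ω n)] (μ : ∀ n, Measure (Ω n))
      [∀ n, IsProbabilityMeasure (μ n)]
      -- the signal matrix and its eigendecomposition
      (M : ∀ n, Matrix (Fin n) (Fin n) ℝ) (U : ∀ n, Matrix (Fin n) (Fin (k n)) ℝ)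
      (lam : ∀ n, Fin (k n) → ℝ)
      -- the noise matrix and its level `E_n`
      (E : ∀ n, Ω n → Matrix (Fin n) (Fin n) ℝ) (En : ℕ → ℝ)
      -- the sketching matrices and the output of the algorithm
      (G : ∀ n, Fin (a n) → Ω n → Matrix (Fin n) (Fin (kt n)) ℝ)
      (Uhat : ∀ n, Ω n → Matrix (Fin n) (Fin (k n)) ℝ)
      (β : ℝ) (g : ℕ),
      (∀ᶠ n in atTop, IsEigendecomposition (M n) (U n) (lam n)) →
      (∀ᶠ n in atTop, ∀ i j, Measurable (fun ω => E n ω i j)) →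
      (∀ᶠ n in atTop, ∀ ω, (E n ω).IsSymm) →
      0 < β →
      -- signal-to-noise ratio, with `S_n = ‖M n‖`
      (∃ c : ℝ, 0 < c ∧ ∀ᶠ n : ℕ in atTop, c * (n : ℝ) ^ β ≤ ‖M n‖ / En n) →
      (∀ᶠ n : ℕ in atTop, WithProbAtLeast (μ n) (1 - ((n : ℝ) ^ 6)⁻¹) (fun ω => ‖E n ω‖ ≤ En n)) →
      ((fun n => condNumber (lam n)) =o[atTop] (fun n => ‖M n‖ / En n)) →
      (∀ᶠ n in atTop, IsGaussianSketch (μ n) (G n) (E n)) →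
      (∀ᶠ n in atTop, ∀ᵐ ω ∂(μ n),
        IsRsRSVDOutput g (M n + E n ω) (fun b => G n b ω) (Uhat n ω)) →
      1 + (2 * β)⁻¹ ≤ (g : ℝ) →
      ∃ c : ℝ, 0 < c ∧ ∀ᶠ n : ℕ in atTop,
        WithProbAtLeast (μ n) (1 - ((n : ℝ) ^ 5)⁻¹) (fun ω =>
          d2 (Uhat n ω) (U n) ≤ √2 * sinThetaNorm (Uhat n ω) (U n) ∧
          √2 * sinThetaNorm (Uhat n ω) (U n) ≤
            c * (vartheta n (kt n) * condNumber (lam n) ^ g * (En n / ‖M n‖))) := by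
  refine ⟨repetitionConst, repetitionConst_pos, fun k₀ => by norm_num [repetitionConst], ?_⟩
  intro r k kt a hr hk ha Ω _ μ _ M U lam E En G Uhat β g hM hEmeas hEsymm hβ hsnr hEprob hcond
    hG hout hg
  obtain ⟨K, hK, hlev⟩ := exists_goodLevels_of_regime hr hk ha
  obtain ⟨c, hc, hsnr⟩ := hsnr
  refine ⟨√2 * (4 + 4 ^ (g - 1) * 2 ^ g * √K * (c⁻¹) ^ (g - 1)), by positivity, ?_⟩
  filter_upwards [hlev, hk, hM, hEmeas, hEsymm, hsnr, hEprob,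
    hcond.bound (c := 1 / 16) (by norm_num), hG, hout, eventually_ge_atTop 2] with n
    ⟨s, T, hs, hT, hlev⟩ ⟨hk1, hkkt⟩ hM hEmeas hEsymm hsnr hEprob hcond hG hout hn2
  have hn1 : (2 : ℝ) ≤ n := by exact_mod_cast hn2
  have hratio : 0 < ‖M n‖ / En n := lt_of_lt_of_le (by positivity) hsnr
  have hEn : 0 < En n := by
    by_contra hcon
    exact absurd hratio (not_lt.2 (div_nonpos_of_nonneg_of_nonpos (norm_nonneg _)
      (not_lt.1 hcon)))
  have hS : 0 < ‖M n‖ := by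
    rcases (norm_nonneg (M n)).eq_or_lt with h0 | h0
    · rw [← h0, zero_div] at hratio; exact absurd hratio (lt_irrefl _)
    · exact h0
  have hk0 : 0 < k n := hk1
  set l : ℝ := |lam n ⟨k n - 1, Nat.sub_lt hk0 one_pos⟩|
  set L : ℝ := |lam n ⟨0, hk0⟩|
  have hl : 0 < l := abs_pos.2 (hM.ne_zero _)
  have hlL : l ≤ L := hM.abs_last_le hk0 _
  have hL0 : 0 < L := hl.trans_le hlL
  have hSL : ‖M n‖ ≤ L := hM.norm_le hL0.le (hM.abs_le_first hk0)
  have hψ : condNumber (lam n) = L / l := by rw [condNumber, dif_pos hk0, abs_div]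
  have hεl : 16 * En n ≤ l := by
    -- Since `‖M‖ ≤ L`, the bound `L / l ≤ (1 / 16) ‖M‖ / E_n` lets `L` cancel.
    rw [hψ, Real.norm_of_nonneg (by positivity), Real.norm_of_nonneg hratio.le] at hcond
    have h1 : L / l ≤ 1 / 16 * (L / En n) := hcond.trans (by gcongr)
    rw [div_le_iff₀ hl] at h1
    have h2 : L * (16 * En n) ≤ L * l := by
      have := mul_le_mul_of_nonneg_right h1 (by positivity : 0 ≤ 16 * En n)
      refine this.trans (le_of_eq ?_)
      field_simp
    exact le_of_mul_le_mul_left h2 hL0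
  have hg0 : g ≠ 0 := by
    rintro rfl
    have : (0 : ℝ) < (2 * β)⁻¹ := by positivity
    rw [Nat.cast_zero] at hg
    linarith
  have hv : 1 ≤ vartheta n (kt n) := le_max_left _ _
  have hgood := hG.measure_not_le hEmeas hlev (M n) (U n) g
  apply withProbAtLeast_of_measure_compl_le (by positivity)
  have hsub : {ω | ¬ (d2 (Uhat n ω) (U n) ≤ √2 * sinThetaNorm (Uhat n ω) (U n) ∧
      √2 * sinThetaNorm (Uhat n ω) (U n) ≤
        √2 * (4 + 4 ^ (g - 1) * 2 ^ g * √K * (c⁻¹) ^ (g - 1)) *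
          (vartheta n (kt n) * condNumber (lam n) ^ g * (En n / ‖M n‖)))} ⊆
      ({ω | ¬ ‖E n ω‖ ≤ En n} ∪
        {ω | ¬ IsRsRSVDOutput g (M n + E n ω) (fun b => G n b ω) (Uhat n ω)}) ∪
      {ω | ¬ ((∃ b, ∀ z, s * ‖Matrix.toEuclideanLin ((M n + E n ω) ^ g * U n) z‖ ≤
        ‖Matrix.toEuclideanLin (G n b ω)ᵀ
          (Matrix.toEuclideanLin ((M n + E n ω) ^ g * U n) z)‖) ∧
        ∀ b v, ‖Matrix.toEuclideanLin (G n b ω) v‖ ≤ √T * ‖v‖)} := by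
    intro ω hω
    by_contra hcon
    simp only [Set.mem_union, not_or, Set.mem_ofPred_eq, not_not] at hcon
    obtain ⟨⟨hE, b, hbmax, hV⟩, ⟨b', hb'⟩, hfrob⟩ := hcon
    apply hω
    refine ⟨d2_le_sqrt_two_mul_sinThetaNorm hV.orthonormal hM.orthonormal, ?_⟩
    -- Only `b'` is known to be well conditioned; maximality of the selected index `b` transfers its
    -- singular value bound.
    have hsv := (hM.le_sv hk1 (hM.abs_last_le hk0) hE hl hεl (hEsymm ω) (G n b' ω) hs.le
      hb').trans (hbmax b')
    have h1 := hM.sinThetaNorm_le (hM.abs_last_le hk0) hE hl hεl hkkt hg0 hV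
      (by positivity : 0 < s * (l / 2) ^ g) hsv (Real.sqrt_nonneg T) (hfrob b)
    have h2 := error_le (by omega : 1 ≤ n) hl hlL hS hSL hEn hs hK hc hβ hg hT hsnr
    rw [mul_assoc, hψ]
    gcongr
    refine (h1.trans h2).trans ?_
    gcongr
    exact le_mul_of_one_le_left (by positivity) hv
  refine (measure_mono hsub).trans ((measure_union_le _ _).trans
    ((add_le_add ((measure_union_le _ _).trans (add_le_add hEprob.measure_compl_le
      (ae_iff.1 hout).le)) hgood).trans ?_))
  rw [add_zero, ← ENNReal.ofReal_add (by positivity) (by positivity),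
    ← ENNReal.ofReal_add (by positivity) (by positivity)]
  apply ENNReal.ofReal_le_ofReal
  -- For `n ≥ 2` the failure budget `n⁻⁶ + 2 n⁻⁷` fits into `n⁻⁵` as `1 / 2 + 1 / 4 + 1 / 4`.
  have h6 : ((n : ℝ) ^ 6)⁻¹ ≤ ((n : ℝ) ^ 5)⁻¹ * (1 / 2) := by
    rw [pow_succ, mul_inv]
    gcongr
    rw [one_div]; gcongr
  have h7 : ((n : ℝ) ^ 7)⁻¹ ≤ ((n : ℝ) ^ 5)⁻¹ * (1 / 4) := by
    rw [pow_add (n : ℝ) 5 2, mul_inv]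
    gcongr
    rw [one_div]
    apply inv_anti₀ (by norm_num)
    nlinarith
  linarith
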